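/- Let $T\in\mathbb R$ (the claim being void for $T\le 0$), $U=\{|\zeta|<1\}$, and let $\Omega(t)\subset\mathbb C$, $t\in[0,T)$, be a smooth simply connected Laplacian growth: each $\Omega(t)\ni 0$ is a bounded simply connected domain with $C^\infty$ boundary, and there are potentials $p(\cdot,t)$ with $$\Delta p=-2\pi\delta_0\ \text{ in }\Omega(t),\qquad p=0\ \text{ on }\partial\Omega(t),\qquad v_n=-\frac{\partial p}{\partial n}\ \text{ on }\partial\Omega(t),$$ where $p(\cdot,t)$ is continuous on $\overline{\Omega(t)}\setminus\{0\}$, $n$ is the outward unit normal and $v_n$ is the normal velocity of the moving boundary. Let $z=f(\zeta,t)$ be the conformal map of $U$ onto $\Omega(t)$ with $f(0,t)=0$, $f'(0,t)>0$ (a prime denotes $\partial/\partial\zeta$). The growth being smooth means also that $f(\cdot,t)$ is $C^\infty$ and injective on $\overline U$ with $f'\ne0$ there, that $f$ and all its $\zeta$-derivatives are continuous on $\overline U\times[0,T)$, and that $\partial f/\partial t$ exists and is continuous on $\overline U\times[0,T)$. Put $$\mathcal E[f]=2\pi\log|f'(0,t)|,\qquad \mathcal S[f]=\lim_{\varepsilon\to0+}\Big\{\int_{\Omega(t)\setminus\{|z|\le\varepsilon\}}|\varphi_z|^2\,d\sigma_z+2\pi\log\varepsilon\Big\},\qquad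 \varphi(z)=\log\frac{|(f^{-1})'(z,t)|^2}{|f^{-1}(z,t)|^2},$$ where $f^{-1}(\cdot,t)$ is the inverse of $f(\cdot,t)$, $\varphi_z=\frac12(\varphi_x-i\varphi_y)$ and $\sigma_z$ is the area measure. Let $$\varkappa(\theta,t)=\frac{\mathrm{Re}\big(1+e^{i\theta}f''(e^{i\theta},t)/f'(e^{i\theta},t)\big)}{|f'(e^{i\theta},t)|},\qquad S_f=\frac{f'''}{f'}-\frac32\Big(\frac{f''}{f'}\Big)^2$$ be the curvature of $\partial\Omega(t)$ at $f(e^{i\theta},t)$ and the Schwarzian derivative. Then for all $t\in[0,T)$ the limit defining $\mathcal S[f]$ exists and is finite, and (with one-sided derivatives at $t=0$) $$\frac{d}{dt}\mathcal E[f]=\int_0^{2\pi}\frac{d\theta}{|f'(e^{i\theta},t)|^2},$$ $$\frac{d}{dt}\big(\mathcal S[f]+\mathcal E[f]\big)=2\int_0^{2\pi}\varkappa^2(\theta,t)\,d\theta+\int_0^{2\pi}\frac{2}{|f'(e^{i\theta},t)|^2}\,\mathrm{Re}\big(e^{2i\theta}S_f(e^{i\theta},t)\big)\,d\theta .$$ 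-/

import Mathlib

open Set Metric Filter Topology MeasureTheory
open scoped Real ContDiff

noncomputable section

namespace LaplacianGrowth

/-- `ρ` is a smooth local defining function of the set `D` near the point `z`: close to `z` it is
`C^∞` with non-vanishing differential, and `D` is the set where it is negative. -/
def IsDefiningFunction (D : Set ℂ) (z : ℂ) (ρ : ℂ → ℝ) : Prop :=
  ∃ U : Set ℂ, IsOpen U ∧ z ∈ U ∧ ContDiffOn ℝ ∞ ρ U ∧
    (∀ w ∈ U, fderiv ℝ ρ w ≠ 0) ∧ ∀ w ∈ U, w ∈ D ↔ ρ w < 0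

/-- The boundary of `D` is a `C^∞` interface. -/
def HasSmoothBoundary (D : Set ℂ) : Prop :=
  ∀ z ∈ frontier D, ∃ ρ : ℂ → ℝ, IsDefiningFunction D z ρ ∧ ρ z = 0

/-- `n` is the outward unit normal vector to the boundary of `D` at the boundary point `z`. -/
def IsOutwardUnitNormal (D : Set ℂ) (z n : ℂ) : Prop :=
  ‖n‖ = 1 ∧ ∃ ρ : ℂ → ℝ, IsDefiningFunction D z ρ ∧ ρ z = 0 ∧
    gradient ρ z = ‖gradient ρ z‖ • n

/-- The curve `γ` follows the moving boundaries `∂Ω(s)`, passes through `z` at time `t`, and has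
velocity `w` there. Times range over `[0, T)`, so the velocity at time `0` is one-sided. -/
def FollowsBoundary (Ω : ℝ → Set ℂ) (T t : ℝ) (z : ℂ) (γ : ℝ → ℂ) (w : ℂ) : Prop :=
  γ t = z ∧ (∀ᶠ s in 𝓝[Ico 0 T] t, γ s ∈ frontier (Ω s)) ∧ HasDerivWithinAt γ w (Ico 0 T) t

/-- The boundary `∂Ω(t)` moves at `z`, at time `t`, with velocity `v` in the direction of the unit
normal vector `n`: some curve follows the boundary through `z`, and the velocity of each such curve
has normal component `v`. -/
def HasNormalVelocity (Ω : ℝ → Set ℂ) (T t : ℝ) (z n : ℂ) (v : ℝ) : Prop :=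
  (∃ γ w, FollowsBoundary Ω T t z γ w) ∧
    ∀ γ w, FollowsBoundary Ω T t z γ w → inner ℝ w n = v

/-- `p` solves `Δp = -2π δ₀` in `D` (that is, `p` is the sum of `-log|z|` and a harmonic function
on `D`) and it is continuous up to the boundary of `D`, where it vanishes. -/
def IsPotential (D : Set ℂ) (p : ℂ → ℝ) : Prop :=
  (∃ h : ℂ → ℝ, InnerProductSpace.HarmonicOnNhd h D ∧
    ∀ z ∈ D \ {0}, p z = -Real.log ‖z‖ + h z) ∧
  ContinuousOn p (closure D \ {0}) ∧ ∀ z ∈ frontier D, p z = 0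

/-- A smooth simply connected Laplacian growth on the time interval `[0, T)`: bounded simply
connected domains `Ω(t) ∋ 0` with smooth boundaries and potentials `p(·, t)`, such that
the normal velocity of the boundary is `v_n = -∂p/∂n`. -/
structure IsStrongSolution (T : ℝ) (Ω : ℝ → Set ℂ) (p : ℝ → ℂ → ℝ) : Prop where
  isOpen : ∀ t ∈ Ico 0 T, IsOpen (Ω t)
  bounded : ∀ t ∈ Ico 0 T, Bornology.IsBounded (Ω t)
  zero_mem : ∀ t ∈ Ico 0 T, (0 : ℂ) ∈ Ω t
  simplyConnected : ∀ t ∈ Ico 0 T, SimplyConnectedSpace (Ω t)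
  smooth : ∀ t ∈ Ico 0 T, HasSmoothBoundary (Ω t)
  potential : ∀ t ∈ Ico 0 T, IsPotential (Ω t) (p t)
  kinematic : ∀ t ∈ Ico 0 T, ∀ z ∈ frontier (Ω t), ∀ n, IsOutwardUnitNormal (Ω t) z n →
    ∃ v : ℝ, HasNormalVelocity Ω T t z n v ∧
      HasDerivWithinAt (fun s : ℝ => p t (z + s • n)) (-v) (Iic 0) 0

/-- The `k`-th complex derivative in `ζ` of a map of the closed unit disk; at boundary points it is
the derivative relative to the closed disk. -/
def dζ (k : ℕ) (F : ℂ → ℂ) (ζ : ℂ) : ℂ := iteratedDerivWithin k F (closedBall 0 1) ζ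

/-- `f(·, t)` is the normalized Riemann map of the unit disk onto `Ω(t)`, `t ∈ [0, T)`; it is smooth
and univalent up to the unit circle, it depends continuously on `t` in the `C^∞` topology of the
closed disk, and it is continuously differentiable in `t`. -/
structure IsParametricFunction (T : ℝ) (Ω : ℝ → Set ℂ) (f : ℝ → ℂ → ℂ) : Prop where
  image : ∀ t ∈ Ico 0 T, f t '' ball 0 1 = Ω t
  zero : ∀ t ∈ Ico 0 T, f t 0 = 0
  deriv_zero : ∀ t ∈ Ico 0 T, ∃ a : ℝ, 0 < a ∧ dζ 1 (f t) 0 = a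
  injOn : ∀ t ∈ Ico 0 T, InjOn (f t) (closedBall 0 1)
  smooth : ∀ t ∈ Ico 0 T, ContDiffOn ℂ ∞ (f t) (closedBall 0 1)
  deriv_ne_zero : ∀ t ∈ Ico 0 T, ∀ ζ ∈ closedBall (0 : ℂ) 1, dζ 1 (f t) ζ ≠ 0
  continuousOn : ∀ k : ℕ,
    ContinuousOn (fun q : ℝ × ℂ => dζ k (f q.1) q.2) (Ico 0 T ×ˢ closedBall 0 1)
  time_deriv : ∃ g : ℝ → ℂ → ℂ,
    (∀ t ∈ Ico 0 T, ∀ ζ ∈ closedBall (0 : ℂ) 1,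
      HasDerivWithinAt (fun s => f s ζ) (g t ζ) (Ico 0 T) t) ∧
    ContinuousOn (fun q : ℝ × ℂ => g q.1 q.2) (Ico 0 T ×ˢ closedBall 0 1)

/-- The energy `2π log|F'(0)|`. -/
def energy (F : ℂ → ℂ) : ℝ := 2 * π * Real.log ‖dζ 1 F 0‖

/-- The inverse of the map `F` of the unit disk onto its image. -/
def invMap (F : ℂ → ℂ) : ℂ → ℂ := Function.invFunOn F (ball 0 1)

/-- `φ = log (|(F⁻¹)'|² / |F⁻¹|²)`, the logarithm of the density of the logarithmic metric. -/
def logDensity (F : ℂ → ℂ) (z : ℂ) : ℝ :=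
  Real.log (‖deriv (invMap F) z‖ ^ 2 / ‖invMap F z‖ ^ 2)

/-- The Wirtinger derivative `φ_z = (φ_x - i φ_y) / 2` of a real function. -/
def wirtinger (φ : ℂ → ℝ) (z : ℂ) : ℂ :=
  ((fderiv ℝ φ z 1 : ℂ) - Complex.I * (fderiv ℝ φ z Complex.I : ℂ)) / 2

/-- The regularized Dirichlet integral `∫_{D, |z| > ε} |φ_z|² dσ + 2π log ε` over the image
`D` of the unit disk under `F`. -/
def regularizedAction (F : ℂ → ℂ) (ε : ℝ) : ℝ :=
  (∫ z in (F '' ball 0 1) \ closedBall 0 ε, ‖wirtinger (logDensity F) z‖ ^ 2) +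
    2 * π * Real.log ε

/-- The logarithmic action: the limit of the regularized Dirichlet integrals as `ε → 0+`. -/
def logAction (F : ℂ → ℂ) : ℝ := limUnder (𝓝[>] (0 : ℝ)) (regularizedAction F)

/-- The curvature of the image of the unit circle under `F` at the image of `ζ`. -/
def curvature (F : ℂ → ℂ) (ζ : ℂ) : ℝ :=
  (1 + ζ * dζ 2 F ζ / dζ 1 F ζ).re / ‖dζ 1 F ζ‖

/-- The Schwarzian derivative `F'''/F' - (3/2) (F''/F')²`. -/
def schwarzian (F : ℂ → ℂ) (ζ : ℂ) : ℂ :=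
  dζ 3 F ζ / dζ 1 F ζ - 3 / 2 * (dζ 2 F ζ / dζ 1 F ζ) ^ 2

/-- The boundary point `e^{iθ}` of the unit disk. -/
def circlePt (θ : ℝ) : ℂ := Complex.exp (θ * Complex.I)

end LaplacianGrowth

end

/-! Write h = f''/f', g = ∂f/∂t and Q = g/f'. Pulling φ back by f gives φ_z(f) f' = -(1/ζ + h), and
the Jacobian |f'|² cancels, so the regularized integral is that of |1/ζ + h|² over the preimage of
{|z| > ε}. Expanding the square, |ζ|⁻² combines with 2π log ε to give 2π log|f'(0)| in the limit,
the cross term has zero mean on circles, and what remains is the Dirichlet integral D of log f'.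
Hence S = D + E (`tendsto_regularizedAction`) and S + E = D + 2E.

The dynamics enters through one equation. Since p(f(ζ)) = -log|ζ|, the growth law becomes Re(conj g
· ζ f') = 1 on the circle (`re_conj_mul_eq_one`), that is Re(Q/ζ) = 1/|f'|². As g(0) = 0, Q/ζ is
holomorphic with value g'(0)/f'(0) at 0, and its mean over the circle gives dE/dt.

For dD/dt, note ∂h/∂t = V' with V = g'/f' = Q' + Qh, so Green's formula turns the variation of D
over the disk of radius r into the circle integral of Re(V conj(ζh)). Only g, not g', is assumed
continuous up to the unit circle; integrating by parts along the circle moves the derivative off Q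
and leaves `boundaryVariation`, which involves only Q, h, h' and passes to r = 1
(`hasDerivWithinAt_diskIntegral_one`).

At r = 1 put q = Q/ζ, a = ζh, b = ζ²h', w = 2a + b. The identity Re(q conj w) = 2 Re q Re w - Re(q
w), together with ∫ q w dθ = 0 (because w vanishes at 0), leaves Re q = 1/|f'|² times 4 Re a + 2 Re
b + |a|². This factor equals 2(Re(1 + a))² + 2 Re(b - a²/2) - 2: the curvature term, the Schwarzian
term, and -2 dE/dt (`variation_integrand_eq`), the last being cancelled by the 2E above. -/

noncomputable section

namespace LaplacianGrowth

/-! ### Integrals depending on a real parameter. -/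

section Parametric

variable {E : Type*} [NormedAddCommGroup E] [NormedSpace ℝ E]

/-- A parameter-dependent function with jointly continuous parameter derivative is differentiable
in the parameter uniformly on compact sets. -/
theorem eventually_norm_sub_sub_smul_le {Y : Type*} [TopologicalSpace Y] {I : Set ℝ}
    (hI : Convex ℝ I) {K : Set Y} (hK : IsCompact K) {F G : ℝ → Y → E}
    (hF : ∀ t ∈ I, ∀ y ∈ K, HasDerivWithinAt (fun s => F s y) (G t y) I t)
    (hG : ContinuousOn (fun q : ℝ × Y => G q.1 q.2) (I ×ˢ K)) {t : ℝ} (ht : t ∈ I)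
    {ε : ℝ} (hε : 0 < ε) :
    ∀ᶠ s in 𝓝[I] t, ∀ y ∈ K, ‖F s y - F t y - (s - t) • G t y‖ ≤ ε * |s - t| := by
  obtain ⟨v, hv, hvG⟩ := hK.mem_uniformity_of_prod (f := G) hG ht (Metric.dist_mem_uniformity hε)
  obtain ⟨δ, hδ, hδv⟩ := Metric.mem_nhdsWithin_iff.1 hv
  have hb : ball t δ ∩ I ∈ 𝓝[I] t := inter_comm _ _ ▸ inter_mem_nhdsWithin I (ball_mem_nhds t hδ)
  filter_upwards [hb] with s hs y hy
  have hconv : Convex ℝ (ball t δ ∩ I) := (convex_ball t δ).inter hI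
  -- Once the linear part is subtracted, the derivative is G x y - G t y, which is at most ε
  -- uniformly over K, and the mean value inequality applies on a convex set.
  have hd : ∀ x ∈ ball t δ ∩ I, HasDerivWithinAt (fun s => F s y - s • G t y)
      (G x y - G t y) (ball t δ ∩ I) x := by
    intro x hx
    have h1 := (hF x hx.2 y hy).mono (inter_subset_right : ball t δ ∩ I ⊆ I)
    have h2 := ((hasDerivAt_id x).smul_const (G t y)).hasDerivWithinAt (s := ball t δ ∩ I)
    simpa using h1.fun_sub h2
  have hbd : ∀ x ∈ ball t δ ∩ I, ‖G x y - G t y‖ ≤ ε := by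
    intro x hx
    have := hvG x (hδv hx) y hy
    rw [Set.mem_ofPred_eq, dist_eq_norm] at this
    exact this.le
  have := hconv.norm_image_sub_le_of_norm_hasDerivWithin_le hd hbd ⟨mem_ball_self hδ, ht⟩ hs
  rw [Real.norm_eq_abs] at this
  convert this using 2
  rw [sub_smul]; abel

theorem continuousOn_parametric_intervalIntegral {X : Type*} [TopologicalSpace X] {S : Set X}
    {a b : ℝ} (hab : a ≤ b) {F : X → ℝ → E}
    (hF : ContinuousOn (fun q : X × ℝ => F q.1 q.2) (S ×ˢ Icc a b)) :
    ContinuousOn (fun x => ∫ y in a..b, F x y) S := by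
  rw [continuousOn_iff_continuous_domRestrict]
  -- Precomposing with the projection onto [a, b] extends F continuously to all y without changing
  -- the integral.
  have h1 : Continuous (Function.uncurry fun (x : S) (y : ℝ) => F x (projIcc a b hab y)) := by
    refine hF.comp_continuous (f := fun q : S × ℝ => ((q.1 : X), (projIcc a b hab q.2 : ℝ))) ?_ ?_
    · fun_prop
    · exact fun q => ⟨q.1.2, (projIcc a b hab q.2).2⟩
  refine (intervalIntegral.continuous_parametric_intervalIntegral_of_continuous'
    (μ := volume) h1 a b).congr ?_
  intro x
  refine intervalIntegral.integral_congr fun y hy => ?_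
  rw [uIcc_of_le hab] at hy
  simp [projIcc_of_mem hab hy]

theorem hasDerivWithinAt_parametric_intervalIntegral {I : Set ℝ} (hI : Convex ℝ I)
    {a b : ℝ} (hab : a ≤ b) {F G : ℝ → ℝ → E}
    (hF : ∀ t ∈ I, ∀ y ∈ Icc a b, HasDerivWithinAt (fun s => F s y) (G t y) I t)
    (hFc : ∀ t ∈ I, ContinuousOn (F t) (Icc a b))
    (hG : ContinuousOn (fun q : ℝ × ℝ => G q.1 q.2) (I ×ˢ Icc a b)) {t : ℝ} (ht : t ∈ I) :
    HasDerivWithinAt (fun s => ∫ y in a..b, F s y) (∫ y in a..b, G t y) I t := by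
  have hGc : ∀ t ∈ I, ContinuousOn (G t) (Icc a b) := fun t ht =>
    hG.comp (f := fun y => (t, y)) (by fun_prop) fun y hy => ⟨ht, hy⟩
  rw [hasDerivWithinAt_iff_isLittleO, Asymptotics.isLittleO_iff]
  intro c hc
  -- The extra 1 keeps the denominator positive when a = b.
  have hc' : 0 < c / (b - a + 1) := div_pos hc (by linarith)
  filter_upwards [eventually_norm_sub_sub_smul_le hI isCompact_Icc hF hG ht hc',
    self_mem_nhdsWithin] with s hs hsI
  have hi : ∀ t ∈ I, IntervalIntegrable (F t) volume a b := fun t ht =>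
    (hFc t ht).intervalIntegrable_of_Icc hab
  have hiG : IntervalIntegrable (fun y => (s - t) • G t y) volume a b :=
    ((hGc t ht).const_smul (s - t)).intervalIntegrable_of_Icc hab
  rw [← intervalIntegral.integral_sub (hi s hsI) (hi t ht), ← intervalIntegral.integral_smul,
    ← intervalIntegral.integral_sub ((hi s hsI).sub (hi t ht)) hiG]
  refine (intervalIntegral.norm_integral_le_of_norm_le_const (C := c / (b - a + 1) * |s - t|)
    fun y hy => ?_).trans ?_
  · rw [uIoc_of_le hab] at hy
    exact hs y ⟨hy.1.le, hy.2⟩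
  · rw [Real.norm_eq_abs, abs_of_nonneg (sub_nonneg.2 hab), mul_right_comm]
    refine mul_le_mul_of_nonneg_right ?_ (abs_nonneg _)
    rw [div_mul_eq_mul_div, div_le_iff₀ (by linarith)]
    nlinarith

end Parametric

/-! ### Time-dependent families of holomorphic functions. -/

section HolomorphicFamily

/-- The spatial derivative of a time-dependent family of holomorphic functions is differentiable in
time, with derivative the spatial derivative of the time derivative. -/
theorem hasDerivWithinAt_deriv_of_holomorphic {I : Set ℝ} (hI : Convex ℝ I)
    (hIu : UniqueDiffOn ℝ I) {U : Set ℂ} (hU : IsOpen U) {F G : ℝ → ℂ → ℂ}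
    (hFh : ∀ t ∈ I, DifferentiableOn ℂ (F t) U)
    (hF : ∀ t ∈ I, ∀ z ∈ U, HasDerivWithinAt (fun s => F s z) (G t z) I t)
    (hG : ContinuousOn (fun q : ℝ × ℂ => G q.1 q.2) (I ×ˢ U)) {t : ℝ} (ht : t ∈ I) :
    DifferentiableOn ℂ (G t) U ∧
      ∀ z ∈ U, HasDerivWithinAt (fun s => deriv (F s) z) (deriv (G t) z) I t := by
  have hne : (𝓝[I \ {t}] t).NeBot := by
    have := (hIu t ht).accPt
    rwa [accPt_principal_iff_nhdsWithin] at this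
  -- The holomorphic difference quotients converge locally uniformly, so by Weierstrass the limit is
  -- holomorphic and the spatial derivatives converge too.
  have hT : TendstoLocallyUniformlyOn (fun (s : ℝ) z => (s - t)⁻¹ • (F s z - F t z)) (G t)
      (𝓝[I \ {t}] t) U := by
    rw [tendstoLocallyUniformlyOn_iff_forall_isCompact hU]
    intro K hKU hK
    rw [Metric.tendstoUniformlyOn_iff]
    intro ε hε
    have h1 := eventually_norm_sub_sub_smul_le hI hK (fun t ht y hy => hF t ht y (hKU hy))
      (hG.mono (prod_mono le_rfl hKU)) ht (half_pos hε)
    filter_upwards [nhdsWithin_mono t sdiff_subset h1, self_mem_nhdsWithin] with s hs hst y hy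
    have hst' : s - t ≠ 0 := sub_ne_zero.2 hst.2
    have h2 := hs y hy
    rw [dist_comm, dist_eq_norm]
    have h3 : (s - t)⁻¹ • (F s y - F t y) - G t y
        = (s - t)⁻¹ • (F s y - F t y - (s - t) • G t y) := by
      rw [smul_sub _ (F s y - F t y), smul_smul, inv_mul_cancel₀ hst', one_smul]
    rw [h3, norm_smul, norm_inv, Real.norm_eq_abs, inv_mul_lt_iff₀ (abs_pos.2 hst')]
    have := abs_pos.2 hst'
    nlinarith
  have hd : ∀ᶠ s in 𝓝[I \ {t}] t,
      DifferentiableOn ℂ (fun z => (s - t)⁻¹ • (F s z - F t z)) U := by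
    filter_upwards [self_mem_nhdsWithin] with s hs
    exact ((hFh s hs.1).fun_sub (hFh t ht)).fun_const_smul ((s - t)⁻¹ : ℝ)
  refine ⟨hT.differentiableOn hd hU, fun z hz => ?_⟩
  rw [hasDerivWithinAt_iff_tendsto_slope]
  refine ((hT.deriv hd hU).tendsto_at hz).congr' ?_
  filter_upwards [self_mem_nhdsWithin] with s hs
  have h1 := (hFh s hs.1).differentiableAt (hU.mem_nhds hz)
  have h2 := (hFh t ht).differentiableAt (hU.mem_nhds hz)
  simp only [Function.comp_apply, slope_def_module]
  exact ((h1.hasDerivAt.fun_sub h2.hasDerivAt).fun_const_smul ((s - t)⁻¹ : ℝ)).deriv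

/-- Joint continuity makes G s → G t locally uniformly; Weierstrass transfers this to the
derivatives, and continuity of the single function `deriv (G t)` completes the estimate. -/
theorem continuousOn_deriv_of_holomorphic {X : Type*} [TopologicalSpace X] {I : Set X}
    {U : Set ℂ} (hU : IsOpen U) {G : X → ℂ → ℂ}
    (hGh : ∀ t ∈ I, DifferentiableOn ℂ (G t) U)
    (hG : ContinuousOn (fun q : X × ℂ => G q.1 q.2) (I ×ˢ U)) :
    ContinuousOn (fun q : X × ℂ => deriv (G q.1) q.2) (I ×ˢ U) := by
  rintro ⟨t, z⟩ ⟨ht, hz⟩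
  have hT : TendstoLocallyUniformlyOn G (G t) (𝓝[I] t) U := by
    rw [tendstoLocallyUniformlyOn_iff_forall_isCompact hU]
    intro K hKU hK u hu
    obtain ⟨v, hv, hvG⟩ := hK.mem_uniformity_of_prod (f := G)
      (hG.mono (prod_mono le_rfl hKU)) ht (symm_le_uniformity hu)
    filter_upwards [hv] with s hs y hy
    exact hvG s hs y hy
  have hT' := hT.deriv (by filter_upwards [self_mem_nhdsWithin] with s hs using hGh s hs) hU
  have hc : ContinuousWithinAt (deriv (G t)) U z :=
    (((hGh t ht).deriv hU).continuousOn) z hz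
  have h3 := tendstoLocallyUniformlyOn_iff_filter.1 hT' z hz
  rw [ContinuousWithinAt, nhdsWithin_prod_eq, Uniform.tendsto_nhds_right]
  rw [tendstoUniformlyOnFilter_iff_tendsto] at h3
  have h4 : Tendsto (fun q : X × ℂ => (deriv (G t) z, deriv (G t) q.2)) (𝓝[I] t ×ˢ 𝓝[U] z)
      (uniformity ℂ) := (Uniform.tendsto_nhds_right.1 hc).comp tendsto_snd
  exact h4.uniformity_trans h3

end HolomorphicFamily

/-! ### Integration by parts and mean values on circles. -/

section Circle

theorem hasDerivAt_comp_circleMap {A : ℂ → ℂ} {A' : ℂ} {r θ : ℝ}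
    (hA : HasDerivAt A A' (circleMap 0 r θ)) :
    HasDerivAt (fun θ => A (circleMap 0 r θ)) (circleMap 0 r θ * A' * Complex.I) θ := by
  refine (hA.scomp θ (hasDerivAt_circleMap 0 r θ)).congr_deriv ?_
  rw [smul_eq_mul]; ring

/-- Integration by parts over a circle. -/
theorem integral_circle_mul_conj_deriv {A A' B B' : ℂ → ℂ} {r : ℝ}
    (hA : ∀ z ∈ sphere (0 : ℂ) |r|, HasDerivAt A (A' z) z)
    (hB : ∀ z ∈ sphere (0 : ℂ) |r|, HasDerivAt B (B' z) z)
    (hA' : ContinuousOn A' (sphere (0 : ℂ) |r|)) (hB' : ContinuousOn B' (sphere (0 : ℂ) |r|)) :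
    ∫ θ in (0 : ℝ)..2 * π, circleMap 0 r θ * A' (circleMap 0 r θ) *
        (starRingEnd ℂ) (B (circleMap 0 r θ)) =
      ∫ θ in (0 : ℝ)..2 * π, A (circleMap 0 r θ) *
        (starRingEnd ℂ) (circleMap 0 r θ * B' (circleMap 0 r θ)) := by
  have hm : ∀ θ, circleMap 0 r θ ∈ sphere (0 : ℂ) |r| := circleMap_mem_sphere' 0 r
  have cA : Continuous fun θ => A (circleMap 0 r θ) :=
    continuous_iff_continuousAt.2 fun θ => (hasDerivAt_comp_circleMap (hA _ (hm θ))).continuousAt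
  have cB : Continuous fun θ => B (circleMap 0 r θ) :=
    continuous_iff_continuousAt.2 fun θ => (hasDerivAt_comp_circleMap (hB _ (hm θ))).continuousAt
  have cA' : Continuous fun θ => A' (circleMap 0 r θ) :=
    hA'.comp_continuous (continuous_circleMap 0 r) hm
  have cB' : Continuous fun θ => B' (circleMap 0 r θ) :=
    hB'.comp_continuous (continuous_circleMap 0 r) hm
  have cc := continuous_circleMap 0 r
  have cs := Complex.continuous_conj
  -- The angular derivative of A · conj B is I times the difference of the two integrands, and its
  -- integral over a full period vanishes.
  have hd : ∀ θ ∈ uIcc (0 : ℝ) (2 * π), HasDerivAt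
      (fun θ => A (circleMap 0 r θ) * (starRingEnd ℂ) (B (circleMap 0 r θ)))
      (Complex.I * (circleMap 0 r θ * A' (circleMap 0 r θ) *
        (starRingEnd ℂ) (B (circleMap 0 r θ)) - A (circleMap 0 r θ) *
        (starRingEnd ℂ) (circleMap 0 r θ * B' (circleMap 0 r θ)))) θ := by
    intro θ _
    refine ((hasDerivAt_comp_circleMap (hA _ (hm θ))).mul
      (hasDerivAt_comp_circleMap (hB _ (hm θ))).star).congr_deriv ?_
    simp only [← starRingEnd_apply, map_mul, Complex.conj_I]
    ring
  have i1 : Continuous fun θ => circleMap 0 r θ * A' (circleMap 0 r θ) *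
        (starRingEnd ℂ) (B (circleMap 0 r θ)) := (cc.mul cA').mul (cs.comp cB)
  have i2 : Continuous fun θ => A (circleMap 0 r θ) *
        (starRingEnd ℂ) (circleMap 0 r θ * B' (circleMap 0 r θ)) :=
    cA.mul (cs.comp (cc.mul cB'))
  have h := intervalIntegral.integral_eq_sub_of_hasDerivAt hd
    ((continuous_const.mul (i1.sub i2)).intervalIntegrable _ _)
  have hp : circleMap 0 r (2 * π) = circleMap 0 r 0 := by
    simpa using periodic_circleMap 0 r 0
  rw [hp, sub_self, intervalIntegral.integral_const_mul, intervalIntegral.integral_sub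
    (i1.intervalIntegrable _ _) (i2.intervalIntegrable _ _)] at h
  exact sub_eq_zero.1 ((mul_eq_zero.1 h).resolve_left Complex.I_ne_zero)

theorem integral_circleMap_of_differentiableAt {A : ℂ → ℂ} {s : Set ℂ} (hs : s.Countable)
    (hA : ContinuousOn A (closedBall 0 1)) (hd : ∀ z ∈ ball (0 : ℂ) 1 \ s, DifferentiableAt ℂ A z) :
    ∫ θ in (0 : ℝ)..2 * π, A (circleMap 0 1 θ) = 2 * π * A 0 := by
  have h := circleAverage_of_differentiable_on_off_countable (f := A) (c := 0) (R := 1) hs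
    (by simpa using hA) (by simpa using hd)
  rw [Real.circleAverage_def] at h
  rw [← h, Complex.real_smul, Complex.ofReal_inv, ← mul_assoc]
  push_cast
  rw [mul_inv_cancel₀ (by simp [Real.pi_ne_zero]), one_mul]

end Circle

/-! ### Variation of the Dirichlet integral over disks. -/

section DirichletIntegral

theorem continuous_circleMap_zero : Continuous fun q : ℝ × ℝ => circleMap 0 q.1 q.2 := by
  unfold circleMap; fun_prop

theorem circleMap_zero_eq_mul (r θ : ℝ) : circleMap 0 r θ = r * circleMap 0 1 θ := by
  simp [circleMap]

theorem circleMap_zero_mul_conj (r θ : ℝ) :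
    circleMap 0 r θ * (starRingEnd ℂ) (circleMap 0 r θ) = (r : ℂ) ^ 2 := by
  rw [Complex.mul_conj, Complex.normSq_eq_norm_sq, norm_circleMap_zero, sq_abs]; push_cast; rfl

theorem hasDerivAt_circleMap_radius (r θ : ℝ) :
    HasDerivAt (fun ρ : ℝ => circleMap 0 ρ θ) (circleMap 0 1 θ) r := by
  have h : HasDerivAt (fun ρ : ℝ => (ρ : ℂ) * circleMap 0 1 θ) (1 * circleMap 0 1 θ) r :=
    (Complex.ofRealCLM.hasDerivAt (x := r)).mul_const _
  rw [one_mul] at h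
  exact h.congr_of_eventuallyEq (Eventually.of_forall fun ρ => circleMap_zero_eq_mul ρ θ)

theorem circleMap_mem_ball_of_Icc {r : ℝ} (hr : r < 1) {ρ : ℝ} (hρ : ρ ∈ Icc 0 r) (θ : ℝ) :
    circleMap 0 ρ θ ∈ ball (0 : ℂ) 1 := by
  rw [mem_ball_zero_iff, norm_circleMap_zero, abs_of_nonneg hρ.1]
  exact hρ.2.trans_lt hr

theorem circleMap_mem_closedBall_of_Icc {ρ : ℝ} (hρ : ρ ∈ Icc 0 1) (θ : ℝ) :
    circleMap 0 ρ θ ∈ closedBall (0 : ℂ) 1 := by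
  rw [mem_closedBall_zero_iff, norm_circleMap_zero, abs_of_nonneg hρ.1]
  exact hρ.2

theorem intervalIntegral_re {f : ℝ → ℂ} {a b : ℝ} (hf : IntervalIntegrable f volume a b) :
    (∫ x in a..b, f x).re = ∫ x in a..b, (f x).re := by
  simpa using (Complex.reCLM.intervalIntegral_comp_comm hf).symm

/-- Green's formula on a disk for the Dirichlet pairing of a primitive of `W` and one of `h`. -/
theorem integral_disk_mul_conj {V W h h' : ℂ → ℂ} {r : ℝ} (hr0 : 0 < r) (hr1 : r < 1)
    (hV : ∀ z ∈ ball (0 : ℂ) 1, HasDerivAt V (W z) z)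
    (hh : ∀ z ∈ ball (0 : ℂ) 1, HasDerivAt h (h' z) z)
    (hW : ContinuousOn W (ball 0 1)) (hh' : ContinuousOn h' (ball 0 1)) :
    ∫ ρ in (0 : ℝ)..r, ∫ θ in (0 : ℝ)..2 * π,
        2 * (ρ : ℂ) * (W (circleMap 0 ρ θ) * (starRingEnd ℂ) (h (circleMap 0 ρ θ))) =
      ∫ θ in (0 : ℝ)..2 * π, V (circleMap 0 r θ) *
        (starRingEnd ℂ) (circleMap 0 r θ * h (circleMap 0 r θ)) := by
  have hVc : ContinuousOn V (ball 0 1) := fun z hz => (hV z hz).continuousAt.continuousWithinAt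
  have hhc : ContinuousOn h (ball 0 1) := fun z hz => (hh z hz).continuousAt.continuousWithinAt
  have hcomp : ∀ {A : ℂ → ℂ}, ContinuousOn A (ball 0 1) →
      ContinuousOn (fun q : ℝ × ℝ => A (circleMap 0 q.1 q.2)) (Icc 0 r ×ˢ Icc 0 (2 * π)) :=
    fun hA => hA.comp continuous_circleMap_zero.continuousOn
      fun q hq => circleMap_mem_ball_of_Icc hr1 hq.1 q.2
  have hz := continuous_circleMap_zero.continuousOn (s := Icc 0 r ×ˢ Icc 0 (2 * π))
  have hz1 : ContinuousOn (fun q : ℝ × ℝ => circleMap 0 1 q.2) (Icc 0 r ×ˢ Icc 0 (2 * π)) := by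
    unfold circleMap; fun_prop
  have conj : ∀ {A : ℝ × ℝ → ℂ}, ContinuousOn A (Icc 0 r ×ˢ Icc 0 (2 * π)) →
      ContinuousOn (fun q => (starRingEnd ℂ) (A q)) (Icc 0 r ×ˢ Icc 0 (2 * π)) :=
    fun hA => Complex.continuous_conj.comp_continuousOn hA
  have hπ : (0 : ℝ) ≤ 2 * π := by positivity
  -- Green's formula is obtained by differentiating the boundary integral in the radius and
  -- recognizing the area integrand.
  have hd := fun (ρ : ℝ) (hρ : ρ ∈ Icc 0 r) =>
    hasDerivWithinAt_parametric_intervalIntegral (convex_Icc 0 r) hπ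
      (F := fun ρ θ => V (circleMap 0 ρ θ) *
        (starRingEnd ℂ) (circleMap 0 ρ θ * h (circleMap 0 ρ θ)))
      (G := fun ρ θ => circleMap 0 1 θ * W (circleMap 0 ρ θ) *
          (starRingEnd ℂ) (circleMap 0 ρ θ * h (circleMap 0 ρ θ)) +
        V (circleMap 0 ρ θ) * (starRingEnd ℂ) (circleMap 0 1 θ *
          (h (circleMap 0 ρ θ) + circleMap 0 ρ θ * h' (circleMap 0 ρ θ))))
      (t := ρ) (by
        intro ρ hρ θ _
        have hm := circleMap_mem_ball_of_Icc hr1 hρ θ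
        have e0 := hasDerivAt_circleMap_radius ρ θ
        have e1 := (hV _ hm).scomp ρ e0
        have e2 := (e0.mul ((hh _ hm).scomp ρ e0)).star
        refine ((e1.mul e2).congr_deriv ?_).hasDerivWithinAt
        simp only [← starRingEnd_apply, map_mul, map_add, smul_eq_mul]
        simp only [Function.comp_apply, Pi.mul_apply, map_mul, starRingEnd_apply]
        ring)
      (by
        intro ρ hρ
        have := (hcomp hVc).mul (conj (hz.mul (hcomp hhc)))
        exact this.comp (f := fun θ => (ρ, θ)) (by fun_prop) fun θ hθ => ⟨hρ, hθ⟩)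
      (((hz1.mul (hcomp hW)).mul (conj (hz.mul (hcomp hhc)))).add ((hcomp hVc).mul
        (conj (hz1.mul ((hcomp hhc).add (hz.mul (hcomp hh')))))))
      hρ
  -- After multiplication by ρ, integration by parts on the circle makes the two summands of the
  -- radial derivative equal; this is the source of the factor 2.
  have key : ∀ ρ ∈ Ioo 0 r, (∫ θ in (0 : ℝ)..2 * π, (circleMap 0 1 θ * W (circleMap 0 ρ θ) *
          (starRingEnd ℂ) (circleMap 0 ρ θ * h (circleMap 0 ρ θ)) +
        V (circleMap 0 ρ θ) * (starRingEnd ℂ) (circleMap 0 1 θ *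
          (h (circleMap 0 ρ θ) + circleMap 0 ρ θ * h' (circleMap 0 ρ θ))))) =
      ∫ θ in (0 : ℝ)..2 * π,
        2 * (ρ : ℂ) * (W (circleMap 0 ρ θ) * (starRingEnd ℂ) (h (circleMap 0 ρ θ))) := by
    intro ρ hρ
    have hρ0 : (ρ : ℂ) ≠ 0 := by exact_mod_cast hρ.1.ne'
    have hs : sphere (0 : ℂ) |ρ| ⊆ ball 0 1 := by
      rw [abs_of_pos hρ.1]
      exact (sphere_subset_closedBall).trans (closedBall_subset_ball (hρ.2.trans hr1))
    have ibp := integral_circle_mul_conj_deriv (A := V) (B := fun z => z * h z)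
      (B' := fun z => h z + z * h' z) (r := ρ) (fun z hz => hV z (hs hz))
      (fun z hz => by simpa using (hasDerivAt_id z).fun_mul (hh z (hs hz))) (hW.mono hs)
      ((hhc.add (continuousOn_id.mul hh')).mono hs)
    have sec : ∀ {A : ℝ × ℝ → ℂ}, ContinuousOn A (Icc 0 r ×ˢ Icc 0 (2 * π)) →
        IntervalIntegrable (fun θ => A (ρ, θ)) volume 0 (2 * π) := fun hA =>
      (hA.comp (f := fun θ => (ρ, θ)) (by fun_prop) fun θ hθ =>
        ⟨Ioo_subset_Icc_self hρ, hθ⟩).intervalIntegrable_of_Icc hπ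
    have s1 : IntervalIntegrable (fun θ => circleMap 0 ρ θ * W (circleMap 0 ρ θ) *
          (starRingEnd ℂ) (circleMap 0 ρ θ * h (circleMap 0 ρ θ))) volume 0 (2 * π) :=
      sec ((hz.mul (hcomp hW)).mul (conj (hz.mul (hcomp hhc))))
    have s2 : IntervalIntegrable (fun θ => V (circleMap 0 ρ θ) *
          (starRingEnd ℂ) (circleMap 0 ρ θ * (h (circleMap 0 ρ θ) +
          circleMap 0 ρ θ * h' (circleMap 0 ρ θ)))) volume 0 (2 * π) :=
      sec ((hcomp hVc).mul (conj (hz.mul ((hcomp hhc).add (hz.mul (hcomp hh'))))))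
    rw [← mul_right_inj' hρ0, ← intervalIntegral.integral_const_mul,
      ← intervalIntegral.integral_const_mul]
    calc _ = ∫ θ in (0 : ℝ)..2 * π, (circleMap 0 ρ θ * W (circleMap 0 ρ θ) *
          (starRingEnd ℂ) (circleMap 0 ρ θ * h (circleMap 0 ρ θ)) +
          V (circleMap 0 ρ θ) * (starRingEnd ℂ) (circleMap 0 ρ θ *
          (h (circleMap 0 ρ θ) + circleMap 0 ρ θ * h' (circleMap 0 ρ θ)))) := by
          refine intervalIntegral.integral_congr fun θ _ => ?_
          simp only [circleMap_zero_eq_mul ρ θ, map_mul, Complex.conj_ofReal]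
          ring
      _ = ∫ θ in (0 : ℝ)..2 * π, 2 * (circleMap 0 ρ θ * W (circleMap 0 ρ θ) *
          (starRingEnd ℂ) (circleMap 0 ρ θ * h (circleMap 0 ρ θ))) := by
          rw [intervalIntegral.integral_add s1 s2, ← ibp,
            intervalIntegral.integral_const_mul]
          ring
      _ = _ := by
          refine intervalIntegral.integral_congr fun θ _ => ?_
          have := circleMap_zero_mul_conj ρ θ
          simp only [map_mul]
          linear_combination 2 * W (circleMap 0 ρ θ) *
            (starRingEnd ℂ) (h (circleMap 0 ρ θ)) * this
  have hcont : ContinuousOn (fun ρ : ℝ => ∫ θ in (0 : ℝ)..2 * π,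
      2 * (ρ : ℂ) * (W (circleMap 0 ρ θ) * (starRingEnd ℂ) (h (circleMap 0 ρ θ)))) (Icc 0 r) :=
    continuousOn_parametric_intervalIntegral hπ
      ((by fun_prop : ContinuousOn (fun q : ℝ × ℝ => 2 * (q.1 : ℂ)) _).mul
        ((hcomp hW).mul (conj (hcomp hhc))))
  -- The lower endpoint contributes nothing, since the boundary integrand carries the factor conj z,
  -- zero at radius 0.
  rw [intervalIntegral.integral_eq_sub_of_hasDerivAt_of_le hr0.le
    (fun ρ hρ => (hd ρ hρ).continuousWithinAt)
    (fun ρ hρ => (key ρ hρ) ▸ (hd ρ (Ioo_subset_Icc_self hρ)).hasDerivAt (Icc_mem_nhds hρ.1 hρ.2))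
    (hcont.intervalIntegrable_of_Icc hr0.le)]
  simp

/-- The Dirichlet integral `∫ |h|² dσ` over the disk of radius `r`, in polar coordinates. -/
def diskIntegral (h : ℂ → ℂ) (r : ℝ) : ℝ :=
  ∫ ρ in (0 : ℝ)..r, ∫ θ in (0 : ℝ)..2 * π, ρ * ‖h (circleMap 0 ρ θ)‖ ^ 2

/-- The boundary form, on the circle of radius `r`, of the variation of the Dirichlet integral of
`h` along `∂h/∂t = (Q' + Q h)'`. -/
def boundaryVariation (Q h h' : ℂ → ℂ) (r : ℝ) : ℝ :=
  (∫ θ in (0 : ℝ)..2 * π, Q (circleMap 0 r θ) *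
    (((r : ℂ) ^ 2)⁻¹ * (starRingEnd ℂ) (2 * circleMap 0 r θ ^ 2 * h (circleMap 0 r θ) +
        circleMap 0 r θ ^ 3 * h' (circleMap 0 r θ)) +
      h (circleMap 0 r θ) * (starRingEnd ℂ) (circleMap 0 r θ * h (circleMap 0 r θ)))).re

/-- V contains a spatial derivative of ∂f/∂t, which is not controlled at the unit circle. Writing V
= Q' + Qh and integrating Q' by parts removes it. -/
theorem integral_circle_eq_boundaryVariation {Q V h h' : ℂ → ℂ} {r : ℝ} (hr0 : 0 < r) (hr1 : r < 1)
    (hV : ContinuousOn V (ball 0 1))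
    (hQ : ∀ z ∈ ball (0 : ℂ) 1, HasDerivAt Q (V z - Q z * h z) z)
    (hh : ∀ z ∈ ball (0 : ℂ) 1, HasDerivAt h (h' z) z) (hh' : ContinuousOn h' (ball 0 1)) :
    (∫ θ in (0 : ℝ)..2 * π, V (circleMap 0 r θ) *
        (starRingEnd ℂ) (circleMap 0 r θ * h (circleMap 0 r θ))).re =
      boundaryVariation Q h h' r := by
  have hQc : ContinuousOn Q (ball 0 1) := fun z hz => (hQ z hz).continuousAt.continuousWithinAt
  have hhc : ContinuousOn h (ball 0 1) := fun z hz => (hh z hz).continuousAt.continuousWithinAt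
  have hs : sphere (0 : ℂ) |r| ⊆ ball 0 1 := by
    rw [abs_of_pos hr0]
    exact (sphere_subset_closedBall).trans (closedBall_subset_ball hr1)
  -- The factor z² comes from z · conj z = r²: on this circle Q' conj(zh) = r⁻² z Q' conj(z²h), the
  -- form that can be integrated by parts.
  have ibp := integral_circle_mul_conj_deriv (A := Q) (B := fun z => z ^ 2 * h z)
    (B' := fun z => 2 * z * h z + z ^ 2 * h' z) (r := r) (fun z hz => hQ z (hs hz))
    (fun z hz => by simpa using (hasDerivAt_pow 2 z).fun_mul (hh z (hs hz)))
    ((hV.sub (hQc.mul hhc)).mono hs)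
    ((((continuousOn_const.mul continuousOn_id).mul hhc).add
      ((continuousOn_id.pow 2).mul hh')).mono hs)
  have hc : ∀ {A : ℂ → ℂ}, ContinuousOn A (ball 0 1) → Continuous fun θ => A (circleMap 0 r θ) :=
    fun hA => (hA.mono hs).comp_continuous (continuous_circleMap 0 r) (circleMap_mem_sphere' 0 r)
  have cz := continuous_circleMap 0 r
  have cj := Complex.continuous_conj
  have hr : (r : ℂ) ≠ 0 := by exact_mod_cast hr0.ne'
  unfold boundaryVariation
  congr 1
  have i1 : Continuous fun θ => ((r : ℂ) ^ 2)⁻¹ * (circleMap 0 r θ * (V (circleMap 0 r θ) -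
      Q (circleMap 0 r θ) * h (circleMap 0 r θ)) *
      (starRingEnd ℂ) (circleMap 0 r θ ^ 2 * h (circleMap 0 r θ))) :=
    continuous_const.mul ((cz.mul ((hc hV).sub ((hc hQc).mul (hc hhc)))).mul
      (cj.comp ((cz.pow 2).mul (hc hhc))))
  have i2 : Continuous fun θ => Q (circleMap 0 r θ) * (h (circleMap 0 r θ) *
      (starRingEnd ℂ) (circleMap 0 r θ * h (circleMap 0 r θ))) :=
    (hc hQc).mul ((hc hhc).mul (cj.comp (cz.mul (hc hhc))))
  have i3 : Continuous fun θ => ((r : ℂ) ^ 2)⁻¹ * (Q (circleMap 0 r θ) *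
      (starRingEnd ℂ) (circleMap 0 r θ * (2 * circleMap 0 r θ * h (circleMap 0 r θ) +
        circleMap 0 r θ ^ 2 * h' (circleMap 0 r θ)))) :=
    continuous_const.mul ((hc hQc).mul (cj.comp (cz.mul (((continuous_const.mul cz).mul
      (hc hhc)).add ((cz.pow 2).mul (hc hh'))))))
  calc _ = ∫ θ in (0 : ℝ)..2 * π, (((r : ℂ) ^ 2)⁻¹ * (circleMap 0 r θ * (V (circleMap 0 r θ) -
      Q (circleMap 0 r θ) * h (circleMap 0 r θ)) *
      (starRingEnd ℂ) (circleMap 0 r θ ^ 2 * h (circleMap 0 r θ))) +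
      Q (circleMap 0 r θ) * (h (circleMap 0 r θ) *
      (starRingEnd ℂ) (circleMap 0 r θ * h (circleMap 0 r θ)))) := by
        refine intervalIntegral.integral_congr fun θ _ => ?_
        have := circleMap_zero_mul_conj r θ
        have h2 : ((r : ℂ) ^ 2)⁻¹ * (r : ℂ) ^ 2 = 1 := inv_mul_cancel₀ (pow_ne_zero 2 hr)
        rw [← this] at h2 ⊢
        simp only [map_mul, map_pow]
        linear_combination -(V (circleMap 0 r θ) - Q (circleMap 0 r θ) * h (circleMap 0 r θ)) *
          (starRingEnd ℂ) (circleMap 0 r θ) * (starRingEnd ℂ) (h (circleMap 0 r θ)) * h2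
    _ = ∫ θ in (0 : ℝ)..2 * π, (((r : ℂ) ^ 2)⁻¹ * (Q (circleMap 0 r θ) *
      (starRingEnd ℂ) (circleMap 0 r θ * (2 * circleMap 0 r θ * h (circleMap 0 r θ) +
        circleMap 0 r θ ^ 2 * h' (circleMap 0 r θ)))) +
      Q (circleMap 0 r θ) * (h (circleMap 0 r θ) *
      (starRingEnd ℂ) (circleMap 0 r θ * h (circleMap 0 r θ)))) := by
        rw [intervalIntegral.integral_add (i1.intervalIntegrable _ _) (i2.intervalIntegrable _ _),
          intervalIntegral.integral_add (i3.intervalIntegrable _ _) (i2.intervalIntegrable _ _),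
          intervalIntegral.integral_const_mul, intervalIntegral.integral_const_mul, ibp]
    _ = _ := by
        refine intervalIntegral.integral_congr fun θ _ => ?_
        simp only [map_mul, map_pow, map_add]
        ring

/-- Differentiate |h|² under both integrals to get 2 Re(W conj h), then apply Green's formula with W
= V'. All of this takes place at radius r < 1, where holomorphy supplies the regularity. -/
theorem hasDerivWithinAt_diskIntegral {I : Set ℝ} (hI : Convex ℝ I) {Q V W h h' : ℝ → ℂ → ℂ}
    {r : ℝ} (hr0 : 0 < r) (hr1 : r < 1)
    (hV : ∀ t ∈ I, ∀ z ∈ ball (0 : ℂ) 1, HasDerivAt (V t) (W t z) z)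
    (hQ : ∀ t ∈ I, ∀ z ∈ ball (0 : ℂ) 1, HasDerivAt (Q t) (V t z - Q t z * h t z) z)
    (hh : ∀ t ∈ I, ∀ z ∈ ball (0 : ℂ) 1, HasDerivAt (h t) (h' t z) z)
    (hht : ∀ t ∈ I, ∀ z ∈ ball (0 : ℂ) 1, HasDerivWithinAt (fun s => h s z) (W t z) I t)
    (hWc : ContinuousOn (fun q : ℝ × ℂ => W q.1 q.2) (I ×ˢ ball 0 1))
    (hhc : ContinuousOn (fun q : ℝ × ℂ => h q.1 q.2) (I ×ˢ ball 0 1))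
    (hh'c : ∀ t ∈ I, ContinuousOn (h' t) (ball 0 1)) {t : ℝ} (ht : t ∈ I) :
    HasDerivWithinAt (fun s => diskIntegral (h s) r) (boundaryVariation (Q t) (h t) (h' t) r) I t := by
  have hπ : (0 : ℝ) ≤ 2 * π := by positivity
  have hcomp : ∀ {A : ℝ → ℂ → ℂ}, ContinuousOn (fun q : ℝ × ℂ => A q.1 q.2) (I ×ˢ ball 0 1) →
      ContinuousOn (fun q : (ℝ × ℝ) × ℝ => A q.1.1 (circleMap 0 q.1.2 q.2))
        ((I ×ˢ Icc 0 r) ×ˢ Icc 0 (2 * π)) := by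
    intro A hA
    refine hA.comp (f := fun q : (ℝ × ℝ) × ℝ => (q.1.1, circleMap 0 q.1.2 q.2)) ?_
      fun q hq => ⟨hq.1.1, circleMap_mem_ball_of_Icc hr1 hq.1.2 q.2⟩
    unfold circleMap; fun_prop
  have hFc : ContinuousOn (fun q : (ℝ × ℝ) × ℝ => q.1.2 * ‖h q.1.1 (circleMap 0 q.1.2 q.2)‖ ^ 2)
      ((I ×ˢ Icc 0 r) ×ˢ Icc 0 (2 * π)) :=
    (by fun_prop : ContinuousOn (fun q : (ℝ × ℝ) × ℝ => q.1.2) _).mul ((hcomp hhc).norm.pow 2)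
  have hGc : ContinuousOn (fun q : (ℝ × ℝ) × ℝ => q.1.2 * (2 * inner ℝ
      (h q.1.1 (circleMap 0 q.1.2 q.2)) (W q.1.1 (circleMap 0 q.1.2 q.2))))
      ((I ×ˢ Icc 0 r) ×ˢ Icc 0 (2 * π)) :=
    (by fun_prop : ContinuousOn (fun q : (ℝ × ℝ) × ℝ => q.1.2) _).mul
      (continuousOn_const.mul ((hcomp hhc).inner (hcomp hWc)))
  have hd := hasDerivWithinAt_parametric_intervalIntegral hI hr0.le
    (F := fun s ρ => ∫ θ in (0 : ℝ)..2 * π, ρ * ‖h s (circleMap 0 ρ θ)‖ ^ 2)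
    (G := fun s ρ => ∫ θ in (0 : ℝ)..2 * π, ρ * (2 * inner ℝ
      (h s (circleMap 0 ρ θ)) (W s (circleMap 0 ρ θ)))) (t := t)
    (fun s hs ρ hρ => hasDerivWithinAt_parametric_intervalIntegral hI hπ
      (fun s hs θ _ => ((hht s hs _ (circleMap_mem_ball_of_Icc hr1 hρ θ)).norm_sq).const_mul ρ)
      (fun s hs => hFc.comp (f := fun θ => ((s, ρ), θ)) (by fun_prop)
        fun θ hθ => ⟨⟨hs, hρ⟩, hθ⟩)
      (hGc.comp (f := fun q : ℝ × ℝ => ((q.1, ρ), q.2)) (by fun_prop)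
        fun q hq => ⟨⟨hq.1, hρ⟩, hq.2⟩) hs)
    (fun s hs => (continuousOn_parametric_intervalIntegral hπ
      (F := fun q : ℝ × ℝ => fun θ => q.2 * ‖h q.1 (circleMap 0 q.2 θ)‖ ^ 2) hFc).comp
      (f := fun ρ => (s, ρ)) (by fun_prop) fun ρ hρ => ⟨hs, hρ⟩)
    (continuousOn_parametric_intervalIntegral hπ
      (F := fun q : ℝ × ℝ => fun θ => q.2 * (2 * inner ℝ
      (h q.1 (circleMap 0 q.2 θ)) (W q.1 (circleMap 0 q.2 θ)))) hGc) ht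
  refine hd.congr_deriv ?_
  have hW1 : ContinuousOn (W t) (ball 0 1) :=
    hWc.comp (f := fun z => (t, z)) (by fun_prop) fun z hz => ⟨ht, hz⟩
  have hh1 : ContinuousOn (h t) (ball 0 1) :=
    hhc.comp (f := fun z => (t, z)) (by fun_prop) fun z hz => ⟨ht, hz⟩
  rw [← integral_circle_eq_boundaryVariation hr0 hr1
    (fun z hz => (hV t ht z hz).continuousAt.continuousWithinAt) (hQ t ht) (hh t ht) (hh'c t ht),
    ← integral_disk_mul_conj hr0 hr1 (hV t ht) (hh t ht) hW1 (hh'c t ht)]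
  have hPc : ContinuousOn (fun q : ℝ × ℝ => 2 * (q.1 : ℂ) * (W t (circleMap 0 q.1 q.2) *
      (starRingEnd ℂ) (h t (circleMap 0 q.1 q.2)))) (Icc 0 r ×ˢ Icc 0 (2 * π)) := by
    have hm : MapsTo (fun q : ℝ × ℝ => circleMap 0 q.1 q.2) (Icc 0 r ×ˢ Icc 0 (2 * π))
      (ball 0 1) := fun q hq => circleMap_mem_ball_of_Icc hr1 hq.1 q.2
    exact (by fun_prop : ContinuousOn (fun q : ℝ × ℝ => 2 * (q.1 : ℂ)) _).mul
      ((hW1.comp continuous_circleMap_zero.continuousOn hm).mul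
      (Complex.continuous_conj.comp_continuousOn
        (hh1.comp continuous_circleMap_zero.continuousOn hm)))
  rw [intervalIntegral_re ((continuousOn_parametric_intervalIntegral hπ
    (F := fun (ρ θ : ℝ) => 2 * (ρ : ℂ) * (W t (circleMap 0 ρ θ) *
      (starRingEnd ℂ) (h t (circleMap 0 ρ θ)))) hPc).intervalIntegrable_of_Icc hr0.le)]
  refine intervalIntegral.integral_congr fun ρ hρ => ?_
  rw [uIcc_of_le hr0.le] at hρ
  have hsec : IntervalIntegrable (fun θ => 2 * (ρ : ℂ) * (W t (circleMap 0 ρ θ) *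
      (starRingEnd ℂ) (h t (circleMap 0 ρ θ)))) volume 0 (2 * π) :=
    (hPc.comp (f := fun θ => (ρ, θ)) (by fun_prop)
      fun θ hθ => ⟨hρ, hθ⟩).intervalIntegrable_of_Icc hπ
  rw [intervalIntegral_re hsec]
  refine intervalIntegral.integral_congr fun θ _ => ?_
  simp only [Complex.inner]
  rw [mul_comm (W t _) _, mul_comm 2 (ρ : ℂ), mul_assoc, Complex.re_ofReal_mul,
    ← Complex.ofReal_ofNat, Complex.re_ofReal_mul]

theorem tendsto_diskIntegral {h : ℂ → ℂ} (hh : ContinuousOn h (closedBall 0 1)) :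
    Tendsto (diskIntegral h) (𝓝[<] 1) (𝓝 (diskIntegral h 1)) := by
  have hπ : (0 : ℝ) ≤ 2 * π := by positivity
  have hc : ContinuousOn (fun ρ : ℝ => ∫ θ in (0 : ℝ)..2 * π, ρ * ‖h (circleMap 0 ρ θ)‖ ^ 2)
      (Icc 0 1) := by
    refine continuousOn_parametric_intervalIntegral hπ (ContinuousOn.mul (by fun_prop)
      (ContinuousOn.pow (ContinuousOn.norm ?_) 2))
    exact hh.comp continuous_circleMap_zero.continuousOn
      fun q hq => circleMap_mem_closedBall_of_Icc hq.1 q.2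
  have h1 : IntegrableOn (fun ρ : ℝ => ∫ θ in (0 : ℝ)..2 * π, ρ * ‖h (circleMap 0 ρ θ)‖ ^ 2)
      (uIcc 0 1) volume := by
    rw [uIcc_of_le zero_le_one]
    exact hc.integrableOn_Icc
  have h2 := intervalIntegral.continuousOn_primitive_interval h1 1 right_mem_uIcc
  rw [uIcc_of_le zero_le_one] at h2
  exact h2.mono_left (nhdsWithin_le_of_mem (Icc_mem_nhdsLT zero_lt_one))

/-- The variation of the Dirichlet integral over the unit disk, as a boundary integral. -/
theorem hasDerivWithinAt_diskIntegral_one {I : Set ℝ} (hI : Convex ℝ I) {Q V W h h' : ℝ → ℂ → ℂ}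
    (hV : ∀ t ∈ I, ∀ z ∈ ball (0 : ℂ) 1, HasDerivAt (V t) (W t z) z)
    (hQ : ∀ t ∈ I, ∀ z ∈ ball (0 : ℂ) 1, HasDerivAt (Q t) (V t z - Q t z * h t z) z)
    (hh : ∀ t ∈ I, ∀ z ∈ ball (0 : ℂ) 1, HasDerivAt (h t) (h' t z) z)
    (hht : ∀ t ∈ I, ∀ z ∈ ball (0 : ℂ) 1, HasDerivWithinAt (fun s => h s z) (W t z) I t)
    (hWc : ContinuousOn (fun q : ℝ × ℂ => W q.1 q.2) (I ×ˢ ball 0 1))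
    (hQc : ContinuousOn (fun q : ℝ × ℂ => Q q.1 q.2) (I ×ˢ closedBall 0 1))
    (hhc : ContinuousOn (fun q : ℝ × ℂ => h q.1 q.2) (I ×ˢ closedBall 0 1))
    (hh'c : ContinuousOn (fun q : ℝ × ℂ => h' q.1 q.2) (I ×ˢ closedBall 0 1))
    {t : ℝ} (ht : t ∈ I) :
    HasDerivWithinAt (fun s => diskIntegral (h s) 1)
      (boundaryVariation (Q t) (h t) (h' t) 1) I t := by
  have hπ : (0 : ℝ) ≤ 2 * π := by positivity
  have hsub : I ×ˢ ball (0 : ℂ) 1 ⊆ I ×ˢ closedBall 0 1 := prod_mono le_rfl ball_subset_closedBall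
  have hd : ∀ r ∈ Ioo (0 : ℝ) 1, ∀ s ∈ I, HasDerivWithinAt (fun s => diskIntegral (h s) r)
      (boundaryVariation (Q s) (h s) (h' s) r) I s := fun r hr s hs =>
    hasDerivWithinAt_diskIntegral hI hr.1 hr.2 hV hQ hh hht hWc (hhc.mono hsub)
      (fun s hs => (hh'c.mono hsub).comp (f := fun z => (s, z)) (by fun_prop)
        fun z hz => ⟨hs, hz⟩) hs
  have hcomp : ∀ {A : ℝ → ℂ → ℂ}, ContinuousOn (fun q : ℝ × ℂ => A q.1 q.2)
      (I ×ˢ closedBall 0 1) →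
      ContinuousOn (fun q : (ℝ × ℝ) × ℝ => A q.1.1 (circleMap 0 q.1.2 q.2))
        ((I ×ˢ Ioc 0 1) ×ˢ Icc 0 (2 * π)) := by
    intro A hA
    refine hA.comp (f := fun q : (ℝ × ℝ) × ℝ => (q.1.1, circleMap 0 q.1.2 q.2)) ?_
      fun q hq => ⟨hq.1.1, circleMap_mem_closedBall_of_Icc (Ioc_subset_Icc_self hq.1.2) q.2⟩
    unfold circleMap; fun_prop
  -- Joint continuity up to and including radius 1 is what eliminating V bought; radius 0 is left
  -- out because of r⁻².
  have hc : ContinuousOn (fun q : ℝ × ℝ => boundaryVariation (Q q.1) (h q.1) (h' q.1) q.2)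
      (I ×ˢ Ioc 0 1) := by
    refine Complex.continuous_re.comp_continuousOn
      (continuousOn_parametric_intervalIntegral hπ ?_)
    have hz : ContinuousOn (fun q : (ℝ × ℝ) × ℝ => circleMap 0 q.1.2 q.2)
      ((I ×ˢ Ioc 0 1) ×ˢ Icc 0 (2 * π)) := by unfold circleMap; fun_prop
    have hr : ContinuousOn (fun q : (ℝ × ℝ) × ℝ => ((q.1.2 : ℂ) ^ 2)⁻¹)
        ((I ×ˢ Ioc 0 1) ×ˢ Icc 0 (2 * π)) := by
      refine ContinuousOn.inv₀ (by fun_prop) fun q hq => ?_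
      exact pow_ne_zero 2 (by exact_mod_cast hq.1.2.1.ne')
    have cj := Complex.continuous_conj
    exact (hcomp hQc).mul ((hr.mul (cj.comp_continuousOn
      (((continuousOn_const.mul (hz.pow 2)).mul (hcomp hhc)).add ((hz.pow 3).mul (hcomp hh'c))))).add
      ((hcomp hhc).mul (cj.comp_continuousOn (hz.mul (hcomp hhc)))))
  rw [hasDerivWithinAt_iff_isLittleO, Asymptotics.isLittleO_iff]
  intro c hc0
  have hc1 := Metric.continuousWithinAt_iff.1 (hc (t, 1) ⟨ht, zero_lt_one, le_rfl⟩) c hc0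
  obtain ⟨δ, hδ, hδc⟩ := hc1
  filter_upwards [inter_mem_nhdsWithin I (ball_mem_nhds t hδ)] with s hs
  have hlim : ∀ s ∈ I, Tendsto (diskIntegral (h s)) (𝓝[<] 1) (𝓝 (diskIntegral (h s) 1)) :=
    fun s hs => tendsto_diskIntegral
      (hhc.comp (f := fun z => (s, z)) (by fun_prop) fun z hz => ⟨hs, hz⟩)
  -- The increment at radius 1 is the limit of those at r < 1, where the mean value inequality in
  -- time holds with one bound c for all r near 1.
  refine le_of_tendsto (((hlim s hs.1).sub (hlim t ht)).sub_const _).norm ?_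
  have hr : Ioo (max 0 (1 - δ)) 1 ∈ 𝓝[<] (1 : ℝ) :=
    Ioo_mem_nhdsLT (max_lt zero_lt_one (by linarith))
  filter_upwards [hr] with r hr
  have hr0 : 0 < r := (le_max_left _ _).trans_lt hr.1
  have hrδ : 1 - δ < r := (le_max_right _ _).trans_lt hr.1
  have hconv : Convex ℝ (I ∩ ball t δ) := hI.inter (convex_ball t δ)
  have hd' : ∀ x ∈ I ∩ ball t δ, HasDerivWithinAt
      (fun s => diskIntegral (h s) r - s • boundaryVariation (Q t) (h t) (h' t) 1)
      (boundaryVariation (Q x) (h x) (h' x) r - boundaryVariation (Q t) (h t) (h' t) 1)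
      (I ∩ ball t δ) x := by
    intro x hx
    have h1 := (hd r ⟨hr0, hr.2⟩ x hx.1).mono (inter_subset_left : I ∩ ball t δ ⊆ I)
    have h2 := ((hasDerivAt_id x).smul_const
      (boundaryVariation (Q t) (h t) (h' t) 1)).hasDerivWithinAt (s := I ∩ ball t δ)
    rw [one_smul] at h2
    exact h1.fun_sub h2
  have hbd : ∀ x ∈ I ∩ ball t δ, ‖boundaryVariation (Q x) (h x) (h' x) r -
      boundaryVariation (Q t) (h t) (h' t) 1‖ ≤ c := by
    intro x hx
    have := hδc (x := (x, r)) ⟨hx.1, hr0, hr.2.le⟩ (by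
      rw [Prod.dist_eq, max_lt_iff]
      refine ⟨hx.2, ?_⟩
      rw [Real.dist_eq, abs_lt]
      constructor <;> linarith [hr.2])
    rw [dist_eq_norm] at this
    exact this.le
  have := hconv.norm_image_sub_le_of_norm_hasDerivWithin_le hd' hbd ⟨ht, mem_ball_self hδ⟩ hs
  refine le_of_eq_of_le (congrArg _ ?_) this
  rw [sub_smul]; abel

end DirichletIntegral

/-! ### Polar coordinates on annuli. -/

section Polar

variable {E : Type*} [NormedAddCommGroup E] [NormedSpace ℝ E]

theorem complex_polarCoord_symm_eq_circleMap (p : ℝ × ℝ) :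
    Complex.polarCoord.symm p = circleMap 0 p.1 p.2 := by
  simp [circleMap, Complex.exp_mul_I]

/-- The open annulus with radii `a` and `b` about the origin. -/
def annulus (a b : ℝ) : Set ℂ := {z | a < ‖z‖ ∧ ‖z‖ < b}

theorem isOpen_annulus (a b : ℝ) : IsOpen (annulus a b) :=
  (isOpen_lt continuous_const continuous_norm).inter (isOpen_lt continuous_norm continuous_const)

theorem annulus_zero_ae_eq_ball (b : ℝ) : annulus 0 b =ᵐ[volume] ball (0 : ℂ) b := by
  have : annulus 0 b = ball (0 : ℂ) b \ {0} := by
    ext z; simp [annulus, and_comm]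
  rw [this]
  exact sdiff_null_ae_eq_self (measure_singleton 0)

/-- Integration in polar coordinates over an annulus. -/
theorem setIntegral_annulus {a b : ℝ} (ha : 0 ≤ a) (hab : a ≤ b) {φ : ℂ → E} {ψ : ℝ → ℝ → E}
    (hφ : ContinuousOn φ (annulus a b))
    (hψ : ContinuousOn (fun q : ℝ × ℝ => ψ q.1 q.2) (Icc a b ×ˢ univ))
    (hper : ∀ ρ, Function.Periodic (ψ ρ) (2 * π))
    (h : ∀ ρ ∈ Ioo a b, ∀ θ, ρ • φ (circleMap 0 ρ θ) = ψ ρ θ) :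
    IntegrableOn φ (annulus a b) ∧
      ∫ z in annulus a b, φ z = ∫ ρ in a..b, ∫ θ in (0 : ℝ)..2 * π, ψ ρ θ := by
  have hmA := (isOpen_annulus a b).measurableSet
  have hmS : MeasurableSet (Ioo a b ×ˢ Ioo (-π) π) := measurableSet_Ioo.prod measurableSet_Ioo
  have hST : Ioo a b ×ˢ Ioo (-π) π ⊆ polarCoord.target := fun p hp =>
    ⟨ha.trans_lt hp.1.1, hp.2⟩
  have hmem : ∀ p ∈ polarCoord.target,
      circleMap 0 p.1 p.2 ∈ annulus a b ↔ p ∈ Ioo a b ×ˢ Ioo (-π) π := by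
    intro p hp
    have : |p.1| = p.1 := abs_of_pos hp.1
    simp only [annulus, mem_ofPred_eq, norm_circleMap_zero, this]
    exact ⟨fun h => ⟨h, hp.2⟩, fun h => h.1⟩
  -- The weighted integrand ψ is continuous on the closed radial interval, so compactness gives
  -- integrability even if φ is singular at the origin (a = 0).
  have hint : IntegrableOn (fun q : ℝ × ℝ => ψ q.1 q.2) (Ioo a b ×ˢ Ioo (-π) π) := by
    refine ((hψ.mono (prod_mono le_rfl (subset_univ (Icc (-π) π)))).integrableOn_compact
      (isCompact_Icc.prod isCompact_Icc)).mono_set ?_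
    exact prod_mono Ioo_subset_Icc_self Ioo_subset_Icc_self
  refine ⟨⟨hφ.aestronglyMeasurable hmA, ?_⟩, ?_⟩
  · rw [hasFiniteIntegral_iff_enorm, ← lintegral_indicator hmA,
      ← Complex.lintegral_comp_polarCoord_symm]
    refine lt_of_eq_of_lt ?_ hint.2
    rw [← lintegral_indicator polarCoord.open_target.measurableSet, ← lintegral_indicator hmS]
    refine lintegral_congr fun p => ?_
    by_cases hp : p ∈ polarCoord.target
    · rw [indicator_of_mem hp, complex_polarCoord_symm_eq_circleMap]
      by_cases hpS : p ∈ Ioo a b ×ˢ Ioo (-π) π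
      · rw [indicator_of_mem hpS, indicator_of_mem ((hmem p hp).2 hpS)]
        simp only
        rw [← h p.1 hpS.1, enorm_smul, smul_eq_mul, Real.enorm_of_nonneg (ha.trans hpS.1.1.le)]
      · rw [indicator_of_notMem hpS, indicator_of_notMem (fun h => hpS ((hmem p hp).1 h)), smul_zero]
    · rw [indicator_of_notMem hp, indicator_of_notMem (fun h => hp (hST h))]
  · rw [← integral_indicator hmA, ← Complex.integral_comp_polarCoord_symm]
    have : ∫ p in polarCoord.target, p.1 • (annulus a b).indicator φ (Complex.polarCoord.symm p) =
        ∫ p in Ioo a b ×ˢ Ioo (-π) π, ψ p.1 p.2 := by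
      rw [← integral_indicator polarCoord.open_target.measurableSet, ← integral_indicator hmS]
      refine integral_congr_ae (Eventually.of_forall fun p => ?_)
      by_cases hp : p ∈ polarCoord.target
      · simp only [indicator_of_mem hp, complex_polarCoord_symm_eq_circleMap]
        by_cases hpS : p ∈ Ioo a b ×ˢ Ioo (-π) π
        · rw [indicator_of_mem hpS, indicator_of_mem ((hmem p hp).2 hpS), ← h p.1 hpS.1]
        · rw [indicator_of_notMem hpS, indicator_of_notMem (fun h => hpS ((hmem p hp).1 h)),
            smul_zero]
      · simp only [indicator_of_notMem hp, indicator_of_notMem (fun h => hp (hST h))]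
    rw [this, Measure.volume_eq_prod, setIntegral_prod (fun p : ℝ × ℝ => ψ p.1 p.2) hint,
      intervalIntegral.integral_of_le hab, integral_Ioc_eq_integral_Ioo]
    refine setIntegral_congr_fun measurableSet_Ioo fun ρ _ => ?_
    -- Periodicity moves the angle range (-π, π) of polar coordinates to [0, 2π].
    have h1 := (hper ρ).intervalIntegral_add_eq (-π) 0
    rw [zero_add, show -π + 2 * π = π by ring] at h1
    simp only
    rw [← h1, intervalIntegral.integral_of_le (by linarith [Real.pi_pos]),
      integral_Ioc_eq_integral_Ioo]

theorem setIntegral_ball_norm_sq {h : ℂ → ℂ} (hh : ContinuousOn h (closedBall 0 1)) :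
    IntegrableOn (fun z => ‖h z‖ ^ 2) (ball 0 1) ∧
      ∫ z in ball (0 : ℂ) 1, ‖h z‖ ^ 2 = diskIntegral h 1 := by
  rw [← integrableOn_congr_set_ae (annulus_zero_ae_eq_ball 1),
    ← setIntegral_congr_set (annulus_zero_ae_eq_ball 1)]
  refine setIntegral_annulus le_rfl zero_le_one ((hh.mono ?_).norm.pow 2) ?_ ?_ ?_
  · exact fun z hz => mem_closedBall_zero_iff.2 hz.2.le
  · refine ContinuousOn.mul (by fun_prop) (ContinuousOn.pow (ContinuousOn.norm ?_) 2)
    exact hh.comp continuous_circleMap_zero.continuousOn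
      fun q hq => circleMap_mem_closedBall_of_Icc hq.1 q.2
  · exact fun ρ θ => by simp only [(periodic_circleMap 0 ρ) θ]
  · exact fun ρ _ θ => rfl

/-- This is the cross term of |1/z + h|². The polar Jacobian absorbs the 1/|z| singularity, and on
each circle the real part of z h(ρz), holomorphic and zero at 0, has mean zero. -/
theorem setIntegral_ball_re_mul_div {h : ℂ → ℂ} (hh : ContinuousOn h (closedBall 0 1))
    (hd : DifferentiableOn ℂ h (ball 0 1)) :
    IntegrableOn (fun z => 2 * (h z * z).re / ‖z‖ ^ 2) (ball 0 1) ∧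
      ∫ z in ball (0 : ℂ) 1, 2 * (h z * z).re / ‖z‖ ^ 2 = 0 := by
  rw [← integrableOn_congr_set_ae (annulus_zero_ae_eq_ball 1),
    ← setIntegral_congr_set (annulus_zero_ae_eq_ball 1)]
  have hsub : annulus 0 1 ⊆ closedBall 0 1 := fun z hz => mem_closedBall_zero_iff.2 hz.2.le
  have hc : ContinuousOn (fun q : ℝ × ℝ => circleMap 0 1 q.2 * h (circleMap 0 q.1 q.2))
      (Icc 0 1 ×ˢ univ) := by
    refine ContinuousOn.mul (by unfold circleMap; fun_prop) ?_
    exact hh.comp continuous_circleMap_zero.continuousOn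
      fun q hq => circleMap_mem_closedBall_of_Icc hq.1 q.2
  have key := setIntegral_annulus le_rfl zero_le_one (φ := fun z => 2 * (h z * z).re / ‖z‖ ^ 2)
    (ψ := fun ρ θ => 2 * (circleMap 0 1 θ * h (circleMap 0 ρ θ)).re) ?_ ?_ ?_ ?_
  · refine ⟨key.1, key.2.trans ?_⟩
    have : ∀ ρ ∈ uIcc (0 : ℝ) 1,
        ∫ θ in (0 : ℝ)..2 * π, 2 * (circleMap 0 1 θ * h (circleMap 0 ρ θ)).re = 0 := by
      intro ρ hρ
      rw [uIcc_of_le zero_le_one] at hρ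
      have hs : IntervalIntegrable (fun θ => circleMap 0 1 θ * h (circleMap 0 ρ θ)) volume
          0 (2 * π) := (hc.comp (f := fun θ => (ρ, θ)) (t := Icc 0 1 ×ˢ univ) (s := Icc 0 (2 * π))
          (by fun_prop) fun θ _ => ⟨hρ, mem_univ θ⟩).intervalIntegrable_of_Icc (by positivity)
      rw [intervalIntegral.integral_const_mul, ← intervalIntegral_re hs]
      have hm : MapsTo (fun z : ℂ => (ρ : ℂ) * z) (closedBall 0 1) (closedBall 0 1) := by
        intro z hz
        rw [mem_closedBall_zero_iff] at hz ⊢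
        rw [norm_mul, Complex.norm_real, Real.norm_eq_abs, abs_of_nonneg hρ.1]
        exact mul_le_one₀ hρ.2 (norm_nonneg z) hz
      have hm' : MapsTo (fun z : ℂ => (ρ : ℂ) * z) (ball 0 1) (ball 0 1) := by
        intro z hz
        rw [mem_ball_zero_iff] at hz ⊢
        rw [norm_mul, Complex.norm_real, Real.norm_eq_abs, abs_of_nonneg hρ.1]
        exact mul_lt_one_of_nonneg_of_lt_one_right hρ.2 (norm_nonneg z) hz
      have := integral_circleMap_of_differentiableAt (A := fun z => z * h (ρ * z)) countable_empty
        (continuousOn_id.mul (hh.comp (by fun_prop) hm)) (by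
          intro z hz
          have h1 := (hd.comp (by fun_prop) hm').differentiableAt (isOpen_ball.mem_nhds hz.1)
          exact differentiableAt_id.mul h1)
      simp only [← circleMap_zero_eq_mul, zero_mul, mul_zero] at this
      rw [this]; simp
    rw [intervalIntegral.integral_congr this]
    simp
  · refine ContinuousOn.div ?_ (continuous_norm.pow 2).continuousOn fun z hz => ?_
    · exact continuousOn_const.mul
        (Complex.continuous_re.comp_continuousOn ((hh.mono hsub).mul continuousOn_id))
    · exact pow_ne_zero 2 hz.1.ne'
  · exact continuousOn_const.mul (Complex.continuous_re.comp_continuousOn hc)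
  · exact fun ρ θ => by simp only [(periodic_circleMap 0 ρ) θ, (periodic_circleMap 0 1) θ]
  · intro ρ hρ θ
    have hρ0 := hρ.1.ne'
    rw [norm_circleMap_zero, sq_abs, mul_comm (h _), circleMap_zero_eq_mul ρ θ, mul_assoc,
      Complex.re_ofReal_mul, smul_eq_mul]
    field_simp

theorem setIntegral_annulus_inv_norm_sq {s : ℝ} (hs : 0 < s) (hs1 : s ≤ 1) :
    IntegrableOn (fun z : ℂ => (‖z‖ ^ 2)⁻¹) (annulus s 1) ∧
      ∫ z in annulus s 1, (‖z‖ ^ 2)⁻¹ = -(2 * π * Real.log s) := by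
  have key := setIntegral_annulus hs.le hs1 (φ := fun z : ℂ => (‖z‖ ^ 2)⁻¹) (ψ := fun ρ _ => ρ⁻¹)
    ?_ ?_ ?_ ?_
  · refine ⟨key.1, key.2.trans ?_⟩
    simp only [intervalIntegral.integral_const, sub_zero, smul_eq_mul]
    rw [intervalIntegral.integral_const_mul, integral_inv_of_pos hs one_pos, one_div, Real.log_inv]
    ring
  · refine ContinuousOn.inv₀ (continuous_norm.pow 2).continuousOn fun z hz => ?_
    exact pow_ne_zero 2 (hs.trans hz.1).ne'
  · exact ContinuousOn.inv₀ (by fun_prop) fun q hq => (hs.trans_le hq.1.1).ne'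
  · exact fun ρ θ => rfl
  · intro ρ hρ θ
    have : ρ ≠ 0 := (hs.trans hρ.1).ne'
    rw [norm_circleMap_zero, sq_abs, smul_eq_mul]
    field_simp

end Polar

/-! ### The logarithmic action as a Dirichlet integral plus the energy. -/

section Action

theorem det_restrictScalars_toSpanSingleton (a : ℂ) :
    ((ContinuousLinearMap.toSpanSingleton ℂ a).restrictScalars ℝ : ℂ →L[ℝ] ℂ).det = ‖a‖ ^ 2 := by
  rw [← Complex.normSq_eq_norm_sq, ← Algebra.norm_complex_apply, Algebra.norm_apply,
    ContinuousLinearMap.det]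
  congr 1
  ext : 1
  simp [mul_comm]

/-- Locally log|H|² = log H + conj(log H), and ∂_z annihilates the antiholomorphic summand. -/
theorem wirtinger_neg_log_norm_sq {H : ℂ → ℂ} {H' z : ℂ} (hH : HasDerivAt H H' z) (h0 : H z ≠ 0) :
    wirtinger (fun w => -Real.log (‖H w‖ ^ 2)) z = -(H' / H z) := by
  have h1 : HasFDerivAt (fun w => -Real.log (‖H w‖ ^ 2)) _ z :=
    ((hH.hasFDerivAt.restrictScalars ℝ).norm_sq.log (pow_ne_zero 2 (norm_ne_zero_iff.2 h0))).neg
  rw [wirtinger, h1.fderiv]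
  have h2 : (‖H z‖ : ℂ) ^ 2 = H z * (starRingEnd ℂ) (H z) := by
    rw [Complex.mul_conj, Complex.normSq_eq_norm_sq]; push_cast; rfl
  have h3 : (starRingEnd ℂ) (H z) ≠ 0 := by simpa using h0
  have h6 : ∀ v : ℂ, (-((‖H z‖ ^ 2)⁻¹ • 2 • ((innerSL ℝ (H z)).comp
      ((ContinuousLinearMap.toSpanSingleton ℂ H').restrictScalars ℝ)))) v =
      -((‖H z‖ ^ 2)⁻¹ * (2 * (v * ((starRingEnd ℂ) (H z) * H')).re)) := by
    intro v
    simp only [neg_apply, smul_apply, ContinuousLinearMap.comp_apply, innerSL_apply_apply,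
      Complex.inner, smul_eq_mul, nsmul_eq_mul, ContinuousLinearMap.coe_restrictScalars',
      ContinuousLinearMap.toSpanSingleton_apply, Nat.cast_ofNat]
    ring_nf
  -- The Wirtinger combination of the directional derivatives along 1 and I recovers the full
  -- complex number conj(H) H'.
  have h4 : ∀ x : ℂ, (x.re : ℂ) - Complex.I * ((Complex.I * x).re : ℂ) = x := by
    intro x
    apply Complex.ext <;> simp
  have h5 := h4 ((starRingEnd ℂ) (H z) * H')
  rw [h6, h6, one_mul]
  push_cast
  rw [h2]
  generalize (((starRingEnd ℂ) (H z) * H').re : ℂ) = x at h5 ⊢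
  generalize ((Complex.I * ((starRingEnd ℂ) (H z) * H')).re : ℂ) = y at h5 ⊢
  field_simp
  linear_combination -h5

/-- By injectivity the chosen global inverse agrees near F z with the local inverse of the inverse
function theorem. -/
theorem hasDerivAt_invMap {F F1 : ℂ → ℂ} (hinj : InjOn F (ball 0 1))
    (hd : ∀ z ∈ ball (0 : ℂ) 1, HasDerivAt F (F1 z) z)
    (hne : ∀ z ∈ ball (0 : ℂ) 1, F1 z ≠ 0) {z : ℂ} (hz : z ∈ ball (0 : ℂ) 1) :
    HasDerivAt (invMap F) (F1 z)⁻¹ (F z) := by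
  have hdo : DifferentiableOn ℂ F (ball 0 1) := fun z hz =>
    (hd z hz).differentiableAt.differentiableWithinAt
  have hs : HasStrictDerivAt F (F1 z) z := by
    have := (hdo.analyticAt (isOpen_ball.mem_nhds hz)).hasStrictDerivAt
    rwa [(hd z hz).deriv] at this
  have hL := hs.to_localInverse (hne z hz)
  refine hL.hasDerivAt.congr_of_eventuallyEq ?_
  have h1 := (hs.hasStrictFDerivAt_equiv (hne z hz)).eventually_right_inverse
  have h2 : ∀ᶠ w in 𝓝 (F z), hs.localInverse F (F1 z) z (hne z hz) w ∈ ball (0 : ℂ) 1 := by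
    refine hL.hasDerivAt.continuousAt.eventually_mem (isOpen_ball.mem_nhds ?_)
    have : hs.localInverse F (F1 z) z (hne z hz) (F z) = z :=
      (hs.hasStrictFDerivAt_equiv (hne z hz)).localInverse_apply_image
    rwa [this]
  filter_upwards [h1, h2] with w hw1 hw2
  have := hinj.leftInvOn_invFunOn hw2
  rw [← this]
  unfold invMap
  congr 1
  exact hw1.symm

theorem invMap_apply {F : ℂ → ℂ} (hinj : InjOn F (ball 0 1)) {z : ℂ} (hz : z ∈ ball (0 : ℂ) 1) :
    invMap F (F z) = z :=
  hinj.leftInvOn_invFunOn hz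

theorem wirtinger_logDensity {F F1 F2 : ℂ → ℂ} (hinj : InjOn F (ball 0 1))
    (hd : ∀ z ∈ ball (0 : ℂ) 1, HasDerivAt F (F1 z) z)
    (hd1 : ∀ z ∈ ball (0 : ℂ) 1, HasDerivAt F1 (F2 z) z)
    (hne : ∀ z ∈ ball (0 : ℂ) 1, F1 z ≠ 0) {z : ℂ} (hz : z ∈ ball (0 : ℂ) 1) (h0 : z ≠ 0) :
    wirtinger (logDensity F) (F z) = -((z⁻¹ + F2 z / F1 z) / F1 z) := by
  have hI := hasDerivAt_invMap hinj hd hne hz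
  have hz' := invMap_apply hinj hz
  -- Since (F⁻¹)' = 1/F'(F⁻¹), the density is |H|⁻² for the holomorphic H = F⁻¹ · F'(F⁻¹).
  have hH : HasDerivAt (fun w => invMap F w * F1 (invMap F w))
      ((F1 z)⁻¹ * F1 z + z * (F2 z * (F1 z)⁻¹)) (F z) := by
    have h1 := hI.fun_mul (HasDerivAt.comp (F z) (h₂ := F1) (by rw [hz']; exact hd1 z hz) hI)
    simpa only [Function.comp_apply, hz'] using h1
  have hU : F '' ball 0 1 ∈ 𝓝 (F z) := by
    have hcont := hI.continuousAt.eventually_mem (by rw [hz']; exact isOpen_ball.mem_nhds hz)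
    have hs : HasStrictDerivAt F (F1 z) z := by
      have hdo : DifferentiableOn ℂ F (ball 0 1) := fun z hz =>
        (hd z hz).differentiableAt.differentiableWithinAt
      have := (hdo.analyticAt (isOpen_ball.mem_nhds hz)).hasStrictDerivAt
      rwa [(hd z hz).deriv] at this
    rw [← hs.map_nhds_eq (hne z hz)]
    exact image_mem_map (isOpen_ball.mem_nhds hz)
  have heq : logDensity F =ᶠ[𝓝 (F z)]
      fun w => -Real.log (‖invMap F w * F1 (invMap F w)‖ ^ 2) := by
    filter_upwards [hU] with w hw
    obtain ⟨ζ, hζ, rfl⟩ := hw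
    rw [logDensity, (hasDerivAt_invMap hinj hd hne hζ).deriv, invMap_apply hinj hζ,
      ← Real.log_inv, norm_mul, norm_inv]
    congr 1
    rw [mul_pow, mul_inv, inv_pow, div_eq_mul_inv, mul_comm]
  rw [wirtinger, heq.fderiv_eq, ← wirtinger, wirtinger_neg_log_norm_sq hH]
  · rw [hz']
    have := hne z hz
    field_simp
  · rw [hz']
    exact mul_ne_zero h0 (hne z hz)

/-- Conformal invariance: the Jacobian |F'|² of the substitution cancels the factor |F'|⁻² of the
squared gradient. -/
theorem regularizedAction_eq {F F1 F2 : ℂ → ℂ} (hinj : InjOn F (ball 0 1)) (hF0 : F 0 = 0)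
    (hd : ∀ z ∈ ball (0 : ℂ) 1, HasDerivAt F (F1 z) z)
    (hd1 : ∀ z ∈ ball (0 : ℂ) 1, HasDerivAt F1 (F2 z) z)
    (hne : ∀ z ∈ ball (0 : ℂ) 1, F1 z ≠ 0) {ε : ℝ} (hε : 0 < ε) :
    regularizedAction F ε = (∫ z in ball 0 1 ∩ F ⁻¹' (closedBall 0 ε)ᶜ,
      ‖z⁻¹ + F2 z / F1 z‖ ^ 2) + 2 * π * Real.log ε := by
  have hc : ContinuousOn F (ball 0 1) := fun z hz => (hd z hz).continuousAt.continuousWithinAt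
  have hm : MeasurableSet (ball 0 1 ∩ F ⁻¹' (closedBall 0 ε)ᶜ) :=
    (hc.isOpen_inter_preimage isOpen_ball isClosed_closedBall.isOpen_compl).measurableSet
  rw [regularizedAction, sdiff_eq, ← image_inter_preimage,
    integral_image_eq_integral_abs_det_fderiv_smul volume hm
      (fun z hz => ((hd z hz.1).hasFDerivAt.restrictScalars ℝ).hasFDerivWithinAt)
      (hinj.mono inter_subset_left)]
  congr 1
  refine setIntegral_congr_fun hm fun z hz => ?_
  have h0 : z ≠ 0 := by
    rintro rfl
    have := hz.2
    simp [hF0, hε.le] at this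
  have h1 := norm_ne_zero_iff.2 (hne z hz.1)
  rw [det_restrictScalars_toSpanSingleton, wirtinger_logDensity hinj hd hd1 hne hz.1 h0, norm_neg,
    norm_div, abs_of_nonneg (by positivity), smul_eq_mul]
  field_simp

theorem eventually_mul_norm_le {F : ℂ → ℂ} {a : ℂ} (hF0 : F 0 = 0) (hd : HasDerivAt F a 0)
    {δ : ℝ} (hδ : 0 < δ) :
    ∃ r > 0, ∀ z : ℂ, ‖z‖ < r → ‖F z‖ ≤ (‖a‖ + δ) * ‖z‖ ∧ (‖a‖ - δ) * ‖z‖ ≤ ‖F z‖ := by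
  have h := (hasDerivAt_iff_isLittleO.1 hd).def hδ
  obtain ⟨r, hr, hb⟩ := Metric.eventually_nhds_iff.1 h
  refine ⟨r, hr, fun z hz => ?_⟩
  have h1 := hb (y := z) (by simpa using hz)
  rw [hF0, sub_zero, sub_zero, smul_eq_mul] at h1
  have h2 : ‖z * a‖ = ‖a‖ * ‖z‖ := by rw [norm_mul, mul_comm]
  have h3 := norm_sub_norm_le (F z) (z * a)
  have h4 := norm_sub_norm_le (z * a) (F z)
  rw [norm_sub_rev] at h4
  constructor <;> nlinarith

/-- Near 0 the map is almost multiplication by a; away from 0, injectivity and compactness bound |F|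
below. So the preimage of {|z| > ε} lies between two round annuli. -/
theorem annulus_subset_preimage {F : ℂ → ℂ} {a : ℂ} (hinj : InjOn F (closedBall 0 1)) (hF0 : F 0 = 0)
    (hc : ContinuousOn F (closedBall 0 1)) (hd : HasDerivAt F a 0) {δ : ℝ} (hδ : 0 < δ)
    (hδa : δ < ‖a‖) :
    ∀ᶠ ε in 𝓝[>] (0 : ℝ),
      annulus (ε / (‖a‖ - δ)) 1 ⊆ ball 0 1 ∩ F ⁻¹' (closedBall 0 ε)ᶜ ∧
      ball 0 1 ∩ F ⁻¹' (closedBall 0 ε)ᶜ ⊆ annulus (ε / (‖a‖ + δ)) 1 := by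
  obtain ⟨r, hr, hrF⟩ := eventually_mul_norm_le hF0 hd hδ
  have hK : IsCompact (closedBall (0 : ℂ) 1 \ ball 0 r) :=
    (isCompact_closedBall 0 1).diff isOpen_ball
  obtain ⟨m, hm, hmF⟩ : ∃ m > 0, ∀ z ∈ closedBall (0 : ℂ) 1 \ ball 0 r, m ≤ ‖F z‖ := by
    refine hK.exists_forall_le' (hc.norm.mono sdiff_subset) fun z hz => ?_
    rw [norm_pos_iff, ← hF0]
    intro h
    have h1 := hinj hz.1 (mem_closedBall_self zero_le_one) h
    exact hz.2 (h1 ▸ mem_ball_self hr)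
  have hpos : 0 < ‖a‖ + δ := by positivity
  have hpos' : 0 < ‖a‖ - δ := sub_pos.2 hδa
  have hmin : 0 < min m (r * (‖a‖ + δ)) := lt_min hm (mul_pos hr hpos)
  filter_upwards [Ioo_mem_nhdsGT hmin] with ε hε
  have hεm := hε.2.trans_le (min_le_left _ _)
  have hεr := hε.2.trans_le (min_le_right _ _)
  constructor
  · intro z hz
    have hz1 : z ∈ ball (0 : ℂ) 1 := mem_ball_zero_iff.2 hz.2
    refine ⟨hz1, ?_⟩
    rw [mem_preimage, mem_compl_iff, mem_closedBall_zero_iff, not_le]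
    by_cases hzr : ‖z‖ < r
    · have := (div_lt_iff₀ hpos').1 hz.1
      rw [mul_comm] at this
      exact this.trans_le (hrF z hzr).2
    · exact hεm.trans_le (hmF z ⟨ball_subset_closedBall hz1, by simpa using hzr⟩)
  · rintro z ⟨hz1, hz2⟩
    rw [mem_preimage, mem_compl_iff, mem_closedBall_zero_iff, not_le] at hz2
    refine ⟨?_, mem_ball_zero_iff.1 hz1⟩
    rw [div_lt_iff₀ hpos, mul_comm]
    by_cases hzr : ‖z‖ < r
    · exact hz2.trans_le (hrF z hzr).1
    · rw [not_lt] at hzr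
      nlinarith

theorem tendsto_integral_inv_norm_sq {F : ℂ → ℂ} {a : ℂ} (ha : a ≠ 0)
    (hinj : InjOn F (closedBall 0 1)) (hF0 : F 0 = 0)
    (hc : ContinuousOn F (closedBall 0 1)) (hd : HasDerivAt F a 0) :
    (∀ᶠ ε in 𝓝[>] (0 : ℝ), IntegrableOn (fun z : ℂ => (‖z‖ ^ 2)⁻¹)
      (ball 0 1 ∩ F ⁻¹' (closedBall 0 ε)ᶜ)) ∧
    Tendsto (fun ε : ℝ => (∫ z in ball 0 1 ∩ F ⁻¹' (closedBall 0 ε)ᶜ, (‖z‖ ^ 2)⁻¹) +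
      2 * π * Real.log ε) (𝓝[>] 0) (𝓝 (2 * π * Real.log ‖a‖)) := by
  have ha' : 0 < ‖a‖ := norm_pos_iff.2 ha
  have hev : ∀ δ : ℝ, 0 < δ → δ < ‖a‖ → ∀ᶠ ε in 𝓝[>] (0 : ℝ),
      IntegrableOn (fun z : ℂ => (‖z‖ ^ 2)⁻¹) (ball 0 1 ∩ F ⁻¹' (closedBall 0 ε)ᶜ) ∧
      2 * π * Real.log (‖a‖ - δ) ≤ (∫ z in ball 0 1 ∩ F ⁻¹' (closedBall 0 ε)ᶜ, (‖z‖ ^ 2)⁻¹) +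
        2 * π * Real.log ε ∧
      (∫ z in ball 0 1 ∩ F ⁻¹' (closedBall 0 ε)ᶜ, (‖z‖ ^ 2)⁻¹) + 2 * π * Real.log ε ≤
        2 * π * Real.log (‖a‖ + δ) := by
    intro δ hδ hδa
    have hpos : 0 < ‖a‖ + δ := by positivity
    have hpos' : 0 < ‖a‖ - δ := sub_pos.2 hδa
    filter_upwards [annulus_subset_preimage hinj hF0 hc hd hδ hδa, Ioo_mem_nhdsGT hpos']
      with ε hsub hε
    have hε0 := hε.1
    have i1 := setIntegral_annulus_inv_norm_sq (div_pos hε0 hpos)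
      ((div_le_one hpos).2 (by linarith [hε.2]))
    have i2 := setIntegral_annulus_inv_norm_sq (div_pos hε0 hpos') ((div_le_one hpos').2 hε.2.le)
    have hi := i1.1.mono_set hsub.2
    have hnn : ∀ (s : Set ℂ), 0 ≤ᵐ[volume.restrict s] fun z : ℂ => (‖z‖ ^ 2)⁻¹ := fun s =>
      Eventually.of_forall fun z => by positivity
    have l1 := setIntegral_mono_set i1.1 (hnn _) hsub.2.eventuallyLE
    have l2 := setIntegral_mono_set hi (hnn _) hsub.1.eventuallyLE
    rw [i1.2, Real.log_div hε0.ne' hpos.ne'] at l1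
    rw [i2.2, Real.log_div hε0.ne' hpos'.ne'] at l2
    exact ⟨hi, by linarith, by linarith⟩
  refine ⟨(hev (‖a‖ / 2) (by linarith) (by linarith)).mono fun ε h => h.1, ?_⟩
  have hlog : ContinuousAt (fun x : ℝ => 2 * π * Real.log x) ‖a‖ :=
    continuousAt_const.mul (Real.continuousAt_log ha'.ne')
  have hδ0 : ∀ᶠ δ in 𝓝[>] (0 : ℝ), 0 < δ ∧ δ < ‖a‖ := Ioo_mem_nhdsGT ha'
  -- The squeeze is two-staged: δ is fixed first so that the logarithmic bound is on the right side
  -- of x, and only then is ε made small.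
  refine tendsto_order.2 ⟨fun x hx => ?_, fun x hx => ?_⟩
  · have h1 : Tendsto (fun δ : ℝ => 2 * π * Real.log (‖a‖ - δ)) (𝓝[>] 0)
        (𝓝 (2 * π * Real.log ‖a‖)) := by
      refine hlog.tendsto.comp ?_
      have : Tendsto (fun δ : ℝ => ‖a‖ - δ) (𝓝 0) (𝓝 (‖a‖ - 0)) :=
        (continuous_const.sub continuous_id).tendsto 0
      rw [sub_zero] at this
      exact this.mono_left nhdsWithin_le_nhds
    obtain ⟨δ, hδ, hδx⟩ := (hδ0.and (h1.eventually_const_lt hx)).exists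
    exact (hev δ hδ.1 hδ.2).mono fun ε h => hδx.trans_le h.2.1
  · have h1 : Tendsto (fun δ : ℝ => 2 * π * Real.log (‖a‖ + δ)) (𝓝[>] 0)
        (𝓝 (2 * π * Real.log ‖a‖)) := by
      refine hlog.tendsto.comp ?_
      have : Tendsto (fun δ : ℝ => ‖a‖ + δ) (𝓝 0) (𝓝 (‖a‖ + 0)) :=
        (continuous_const.add continuous_id).tendsto 0
      rw [add_zero] at this
      exact this.mono_left nhdsWithin_le_nhds
    obtain ⟨δ, hδ, hδx⟩ := (hδ0.and (h1.eventually_lt_const hx)).exists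
    exact (hev δ hδ.1 hδ.2).mono fun ε h => h.2.2.trans_lt hδx

theorem norm_inv_add_sq {z w : ℂ} (hz : z ≠ 0) :
    ‖z⁻¹ + w‖ ^ 2 = (‖z‖ ^ 2)⁻¹ + (2 * (w * z).re / ‖z‖ ^ 2 + ‖w‖ ^ 2) := by
  have h : z⁻¹ + w = (1 + w * z) / z := by field_simp
  have h0 := norm_ne_zero_iff.2 hz
  have h1 : ‖1 + w * z‖ ^ 2 = 1 + 2 * (w * z).re + ‖w‖ ^ 2 * ‖z‖ ^ 2 := by
    rw [← mul_pow, ← norm_mul, ← Complex.normSq_eq_norm_sq, ← Complex.normSq_eq_norm_sq,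
      Complex.normSq_add]
    simp
    ring
  rw [h, norm_div, div_pow, h1]
  field_simp
  ring

/-- The logarithmic action is the Dirichlet integral of `log F'` plus `2π log |F'(0)|`. -/
theorem tendsto_regularizedAction {F F1 F2 : ℂ → ℂ} (hinj : InjOn F (closedBall 0 1)) (hF0 : F 0 = 0)
    (hc : ContinuousOn F (closedBall 0 1))
    (hd : ∀ z ∈ ball (0 : ℂ) 1, HasDerivAt F (F1 z) z)
    (hd1 : ∀ z ∈ ball (0 : ℂ) 1, HasDerivAt F1 (F2 z) z)
    (hne : ∀ z ∈ ball (0 : ℂ) 1, F1 z ≠ 0)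
    (hhc : ContinuousOn (fun z => F2 z / F1 z) (closedBall 0 1))
    (hhd : DifferentiableOn ℂ (fun z => F2 z / F1 z) (ball 0 1)) :
    Tendsto (regularizedAction F) (𝓝[>] 0)
      (𝓝 (diskIntegral (fun z => F2 z / F1 z) 1 + 2 * π * Real.log ‖F1 0‖)) := by
  have h0 : (0 : ℂ) ∈ ball (0 : ℂ) 1 := mem_ball_self one_pos
  have hsub : InjOn F (ball 0 1) := hinj.mono ball_subset_closedBall
  obtain ⟨hi, ht⟩ := tendsto_integral_inv_norm_sq (hne 0 h0) hinj hF0 hc (hd 0 h0)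
  obtain ⟨c1, c2⟩ := setIntegral_ball_re_mul_div hhc hhd
  obtain ⟨n1, n2⟩ := setIntegral_ball_norm_sq hhc
  have hm : ∀ ε : ℝ, MeasurableSet (ball 0 1 ∩ F ⁻¹' (closedBall 0 ε)ᶜ) := fun ε =>
    ((hc.mono ball_subset_closedBall).isOpen_inter_preimage isOpen_ball
      isClosed_closedBall.isOpen_compl).measurableSet
  have hψ : IntegrableOn (fun z => 2 * (F2 z / F1 z * z).re / ‖z‖ ^ 2 + ‖F2 z / F1 z‖ ^ 2)
      (ball 0 1) := c1.add n1
  have hψint : ∫ z in ball (0 : ℂ) 1, (2 * (F2 z / F1 z * z).re / ‖z‖ ^ 2 + ‖F2 z / F1 z‖ ^ 2) =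
      diskIntegral (fun z => F2 z / F1 z) 1 := by
    rw [integral_add c1 n1, c2, n2, zero_add]
  -- Cross and regular terms are integrable on the whole disk, so dominated convergence fills the
  -- shrinking hole; only |z|⁻² needs the logarithm.
  have hlim : Tendsto (fun ε : ℝ => ∫ z in ball 0 1 ∩ F ⁻¹' (closedBall 0 ε)ᶜ,
      (2 * (F2 z / F1 z * z).re / ‖z‖ ^ 2 + ‖F2 z / F1 z‖ ^ 2)) (𝓝[>] 0)
      (𝓝 (diskIntegral (fun z => F2 z / F1 z) 1)) := by
    rw [← hψint, ← integral_indicator measurableSet_ball]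
    have : ∀ ε : ℝ, ∫ z in ball 0 1 ∩ F ⁻¹' (closedBall 0 ε)ᶜ,
        (2 * (F2 z / F1 z * z).re / ‖z‖ ^ 2 + ‖F2 z / F1 z‖ ^ 2) = ∫ z,
        (ball 0 1 ∩ F ⁻¹' (closedBall 0 ε)ᶜ).indicator
        (fun z => 2 * (F2 z / F1 z * z).re / ‖z‖ ^ 2 + ‖F2 z / F1 z‖ ^ 2) z := fun ε =>
      (integral_indicator (hm ε)).symm
    simp only [this]
    refine tendsto_integral_filter_of_dominated_convergence
      (fun z => ‖(ball (0 : ℂ) 1).indicator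
        (fun z => 2 * (F2 z / F1 z * z).re / ‖z‖ ^ 2 + ‖F2 z / F1 z‖ ^ 2) z‖)
      (Eventually.of_forall fun ε => ?_) (Eventually.of_forall fun ε => ?_) ?_ ?_
    · exact ((hψ.mono_set inter_subset_left).integrable_indicator (hm ε)).aestronglyMeasurable
    · refine Eventually.of_forall fun z => ?_
      exact norm_indicator_le_of_subset inter_subset_left _ z
    · exact (hψ.integrable_indicator measurableSet_ball).norm
    · have hz0 : ∀ᵐ z : ℂ, z ≠ 0 := by
        simp [ae_iff]
      filter_upwards [hz0] with z hz
      by_cases hzb : z ∈ ball (0 : ℂ) 1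
      · have hFz : 0 < ‖F z‖ := by
          rw [norm_pos_iff, ← hF0]
          exact fun h => hz (hsub hzb h0 h)
        refine tendsto_const_nhds.congr' ?_
        filter_upwards [Ioo_mem_nhdsGT hFz] with ε hε
        rw [indicator_of_mem hzb, indicator_of_mem]
        exact ⟨hzb, by simpa using hε.2⟩
      · refine tendsto_const_nhds.congr fun ε => ?_
        rw [indicator_of_notMem hzb, indicator_of_notMem fun h => hzb h.1]
  refine (hlim.add ht).congr' ?_
  filter_upwards [hi, self_mem_nhdsWithin] with ε hε hε0
  rw [regularizedAction_eq hsub hF0 hd hd1 hne hε0, ← add_assoc,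
    add_comm (∫ z in _, (2 * (F2 z / F1 z * z).re / ‖z‖ ^ 2 + ‖F2 z / F1 z‖ ^ 2)),
    ← integral_add hε (hψ.mono_set inter_subset_left)]
  congr 1
  refine setIntegral_congr_fun (hm ε) fun z hz => ?_
  refine (norm_inv_add_sq ?_).symm
  rintro rfl
  have h1 := hz.2
  have h2 : 0 ≤ ε := le_of_lt hε0
  simp [hF0, h2] at h1

end Action

/-! ### The pressure as the Green function of the domain. -/

section Potential

theorem mem_frontier_image_ball {F : ℂ → ℂ} (hinj : InjOn F (closedBall 0 1))
    (hc : ContinuousOn F (closedBall 0 1)) (ho : IsOpen (F '' ball 0 1)) {ζ : ℂ}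
    (hζ : ζ ∈ sphere (0 : ℂ) 1) : F ζ ∈ frontier (F '' ball 0 1) := by
  rw [ho.frontier_eq]
  have hcl : closure (ball (0 : ℂ) 1) = closedBall 0 1 := closure_ball 0 one_ne_zero
  refine ⟨(hcl ▸ hc).image_closure (mem_image_of_mem F (hcl ▸ sphere_subset_closedBall hζ)), ?_⟩
  rintro ⟨w, hw, hwζ⟩
  have := hinj (ball_subset_closedBall hw) (sphere_subset_closedBall hζ) hwζ
  subst this
  rw [mem_ball_zero_iff] at hw
  rw [mem_sphere_zero_iff_norm] at hζ
  exact hw.ne hζ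

/-- Locally h is the real part of a holomorphic function, and composing that with F stays
holomorphic. -/
theorem harmonicAt_comp {h : ℂ → ℝ} {F : ℂ → ℂ} {D : Set ℂ} (hD : IsOpen D)
    (hh : InnerProductSpace.HarmonicOnNhd h D) {z : ℂ} (hF : AnalyticAt ℂ F z) (hz : F z ∈ D) :
    InnerProductSpace.HarmonicAt (fun w => h (F w)) z := by
  obtain ⟨R, hR, hRD⟩ := Metric.isOpen_iff.1 hD _ hz
  obtain ⟨Φ, hΦ, hΦh⟩ := InnerProductSpace.HarmonicOnNhd.exists_analyticOnNhd_ball_re_eq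
    (hh.mono hRD)
  have h1 : AnalyticAt ℂ (fun w => Φ (F w)) z :=
    (hΦ (F z) (mem_ball_self hR)).comp hF
  refine (InnerProductSpace.harmonicAt_congr_nhds ?_).1 h1.harmonicAt_re
  filter_upwards [hF.continuousAt.preimage_mem_nhds (ball_mem_nhds (F z) hR)] with w hw
  exact hΦh hw

theorem eq_zero_of_harmonicContOnCl {W : ℂ → ℝ}
    (hW : InnerProductSpace.HarmonicContOnCl W (ball 0 1)) (h0 : ∀ z ∈ sphere (0 : ℂ) 1, W z = 0)
    {z : ℂ} (hz : z ∈ ball (0 : ℂ) 1) : W z = 0 := by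
  rw [← hW.circleAverage_poissonKernel_smul hz]
  refine Real.circleAverage_const_on_circle fun w hw => ?_
  rw [abs_one] at hw
  simp [h0 w hw]

/-- The potential is `-log |F⁻¹|`. -/
theorem potential_comp_eq {D : Set ℂ} {p : ℂ → ℝ} (hp : IsPotential D p) {F F1 : ℂ → ℂ}
    (hinj : InjOn F (closedBall 0 1)) (hc : ContinuousOn F (closedBall 0 1))
    (ho : IsOpen (F '' ball 0 1)) (hD : F '' ball 0 1 = D) (hF0 : F 0 = 0)
    (hd : ∀ z ∈ ball (0 : ℂ) 1, HasDerivAt F (F1 z) z)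
    (hne : ∀ z ∈ ball (0 : ℂ) 1, F1 z ≠ 0) {ζ : ℂ} (hζ : ζ ∈ closedBall (0 : ℂ) 1) (hζ0 : ζ ≠ 0) :
    p (F ζ) = -Real.log ‖ζ‖ := by
  subst hD
  obtain ⟨⟨h, hh, hph⟩, hpc, hpb⟩ := hp
  have h0b : (0 : ℂ) ∈ ball (0 : ℂ) 1 := mem_ball_self one_pos
  have hdo : DifferentiableOn ℂ F (ball 0 1) := fun z hz =>
    (hd z hz).differentiableAt.differentiableWithinAt
  -- `dslope F 0` is F(z)/z with value F'(0) at 0. It has no zeros in the ball, so its log-modulus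
  -- is harmonic through the origin.
  have hGd : DifferentiableOn ℂ (dslope F 0) (ball 0 1) :=
    (Complex.differentiableOn_dslope (isOpen_ball.mem_nhds h0b)).2 hdo
  have hFne : ∀ z ∈ closedBall (0 : ℂ) 1, z ≠ 0 → F z ≠ 0 := fun z hz hz0 h =>
    hz0 (hinj hz (mem_closedBall_self zero_le_one) (h.trans hF0.symm))
  have hG : ∀ z, z ≠ 0 → dslope F 0 z = F z / z := by
    intro z hz
    rw [dslope_of_ne _ hz, slope_def_field, hF0, sub_zero, sub_zero]
  have hGne : ∀ z ∈ ball (0 : ℂ) 1, dslope F 0 z ≠ 0 := by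
    intro z hz
    by_cases hz0 : z = 0
    · rw [hz0, dslope_same, (hd 0 h0b).deriv]
      exact hne 0 h0b
    · rw [hG z hz0]
      exact div_ne_zero (hFne z (ball_subset_closedBall hz) hz0) hz0
  classical
  -- W extends p(F(z)) + log|z| harmonically across 0. The value 0 off the ball matches p = 0 on the
  -- boundary, so the Poisson formula forces W = 0.
  set W : ℂ → ℝ := fun z => if z ∈ ball (0 : ℂ) 1 then h (F z) - Real.log ‖dslope F 0 z‖ else 0
    with hWdef
  have hWs : ∀ z ∈ sphere (0 : ℂ) 1, W z = 0 := by
    intro z hz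
    have : z ∉ ball (0 : ℂ) 1 := by
      rw [mem_ball_zero_iff, mem_sphere_zero_iff_norm.1 hz]; exact lt_irrefl _
    simp only [hWdef, if_neg this]
  have hWp : ∀ z ∈ closedBall (0 : ℂ) 1, z ≠ 0 → W z = p (F z) + Real.log ‖z‖ := by
    intro z hz hz0
    by_cases hzb : z ∈ ball (0 : ℂ) 1
    · have hn := hFne z hz hz0
      simp only [hWdef, if_pos hzb]
      rw [hph (F z) ⟨mem_image_of_mem F hzb, hn⟩, hG z hz0, norm_div,
        Real.log_div (norm_ne_zero_iff.2 hn) (norm_ne_zero_iff.2 hz0)]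
      ring
    · have hzs : z ∈ sphere (0 : ℂ) 1 := by
        rw [mem_sphere_zero_iff_norm]
        rw [mem_ball_zero_iff, not_lt] at hzb
        exact le_antisymm (mem_closedBall_zero_iff.1 hz) hzb
      rw [hWs z hzs, hpb _ (mem_frontier_image_ball hinj hc ho hzs),
        mem_sphere_zero_iff_norm.1 hzs, Real.log_one, zero_add]
  have hWh : InnerProductSpace.HarmonicOnNhd W (ball 0 1) := by
    intro z hz
    have hb := isOpen_ball.mem_nhds hz
    have h1 := (harmonicAt_comp ho hh (hdo.analyticAt hb) (mem_image_of_mem F hz)).sub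
      ((hGd.analyticAt hb).harmonicAt_log_norm (hGne z hz))
    refine (InnerProductSpace.harmonicAt_congr_nhds ?_).1 h1
    filter_upwards [hb] with w hw
    simp only [hWdef, if_pos hw, Pi.sub_apply]
  have hWc : ContinuousOn W (closedBall 0 1) := by
    intro z hz
    by_cases hz0 : z = 0
    · subst hz0
      exact ((hWh.contDiffOn.continuousOn).continuousAt
        (isOpen_ball.mem_nhds h0b)).continuousWithinAt
    · have hm : MapsTo F (closedBall 0 1 \ {0}) (closure (F '' ball 0 1) \ {0}) := by
        intro w hw
        have hcl : closure (ball (0 : ℂ) 1) = closedBall 0 1 := closure_ball 0 one_ne_zero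
        exact ⟨(hcl ▸ hc).image_closure (mem_image_of_mem F (hcl ▸ hw.1)), hFne w hw.1 hw.2⟩
      have h1 : ContinuousOn (fun w => p (F w) + Real.log ‖w‖) (closedBall 0 1 \ {0}) :=
        (hpc.comp (hc.mono sdiff_subset) hm).add
          (continuous_norm.continuousOn.log fun w hw => norm_ne_zero_iff.2 hw.2)
      have h2 : ContinuousWithinAt W (closedBall 0 1 \ {0}) z :=
        (h1 z ⟨hz, hz0⟩).congr (fun w hw => hWp w hw.1 hw.2) (hWp z hz hz0)
      refine h2.mono_of_mem_nhdsWithin ?_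
      exact inter_mem_nhdsWithin _ (isOpen_compl_singleton.mem_nhds hz0)
  have hzero : W ζ = 0 := by
    by_cases hzb : ζ ∈ ball (0 : ℂ) 1
    · exact eq_zero_of_harmonicContOnCl (InnerProductSpace.HarmonicContOnCl.mk_ball hWh hWc)
        hWs hzb
    · simp only [hWdef, if_neg hzb]
  rw [hWp ζ hζ hζ0] at hzero
  linarith

end Potential

/-! ### The outward normal of the image of the circle. -/

section Normal

/-- The direction `ζ F'(ζ)` is outward normal at `F ζ`. -/
theorem gradient_eq_smul {D : Set ℂ} {F : ℂ → ℂ} {a ζ : ℂ} {ρ : ℂ → ℝ}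
    (hinj : InjOn F (closedBall 0 1)) (hc : ContinuousOn F (closedBall 0 1))
    (ho : IsOpen (F '' ball 0 1)) (hD : F '' ball 0 1 = D) (hζ : ζ ∈ sphere (0 : ℂ) 1)
    (hd : HasDerivWithinAt F a (closedBall 0 1) ζ) (ha : a ≠ 0)
    (hρ : IsDefiningFunction D (F ζ) ρ) :
    gradient ρ (F ζ) ≠ 0 ∧
      gradient ρ (F ζ) = ‖gradient ρ (F ζ)‖ • ((‖a‖ : ℂ)⁻¹ * (ζ * a)) := by
  subst hD
  obtain ⟨U, hUo, hzU, hρs, hρ', hρD⟩ := hρ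
  have hζ1 : ‖ζ‖ = 1 := mem_sphere_zero_iff_norm.1 hζ
  have hρd : ∀ w ∈ U, DifferentiableAt ℝ ρ w := fun w hw =>
    (hρs.differentiableOn (by simp)).differentiableAt (hUo.mem_nhds hw)
  have hfr : ∀ w ∈ U, w ∈ frontier (F '' ball 0 1) → ρ w = 0 := by
    intro w hw hwf
    rw [ho.frontier_eq] at hwf
    refine le_antisymm ?_ (not_lt.1 fun h => hwf.2 ((hρD w hw).2 h))
    by_contra! hpos
    have h1 : ∀ᶠ x in 𝓝 w, 0 < ρ x ∧ x ∈ U :=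
      ((hρd w hw).continuousAt.eventually_const_lt hpos).and (hUo.mem_nhds hw)
    obtain ⟨x, hx, hxD⟩ := mem_closure_iff_nhds.1 hwf.1 _ h1
    exact absurd ((hρD x hx.2).1 hxD) (not_lt.2 hx.1.le)
  have hR : HasFDerivWithinAt (fun w => ρ (F w)) ((fderiv ℝ ρ (F ζ)).comp
      ((ContinuousLinearMap.toSpanSingleton ℂ a).restrictScalars ℝ)) (closedBall 0 1) ζ :=
    (hρd _ hzU).hasFDerivAt.comp_hasFDerivWithinAt ζ (hd.hasFDerivWithinAt.restrictScalars ℝ)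
  have hUev : ∀ᶠ w in 𝓝[closedBall 0 1] ζ, F w ∈ U :=
    (hc ζ (sphere_subset_closedBall hζ)).eventually_mem (hUo.mem_nhds hzU)
  have hL : ∀ v : ℂ, ((fderiv ℝ ρ (F ζ)).comp
      ((ContinuousLinearMap.toSpanSingleton ℂ a).restrictScalars ℝ)) v =
      inner ℝ (gradient ρ (F ζ)) (v * a) := by
    intro v
    rw [gradient, InnerProductSpace.toDual_symm_apply]
    simp
  -- ρ ∘ F vanishes along the circle, so its tangential derivative is zero.
  have htan : inner ℝ (gradient ρ (F ζ)) (ζ * Complex.I * a) = 0 := by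
    obtain ⟨θ, hθ⟩ : ∃ θ : ℝ, circleMap 0 1 θ = ζ := by
      have : ζ ∈ range (circleMap 0 1) := by rw [range_circleMap]; simpa using hζ
      exact this
    have h1 : HasDerivAt (fun θ => ρ (F (circleMap 0 1 θ)))
        (inner ℝ (gradient ρ (F ζ)) (ζ * Complex.I * a)) θ := by
      have h2 := hasDerivAt_circleMap 0 1 θ
      rw [hθ] at h2
      have h3 := HasFDerivWithinAt.comp_hasDerivWithinAt_of_eq (s := univ) θ hR
        (h2.hasDerivWithinAt (s := univ))
        (fun x _ => circleMap_mem_closedBall_of_Icc ⟨zero_le_one, le_rfl⟩ x) hθ.symm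
      rw [hL, hasDerivWithinAt_univ] at h3
      exact h3
    have h4 : (fun θ => ρ (F (circleMap 0 1 θ))) =ᶠ[𝓝 θ] fun _ => 0 := by
      have h5 : Tendsto (circleMap 0 1) (𝓝 θ) (𝓝[closedBall 0 1] ζ) := by
        refine tendsto_nhdsWithin_iff.2 ⟨hθ ▸ (continuous_circleMap 0 1).tendsto θ,
          Eventually.of_forall fun x => circleMap_mem_closedBall_of_Icc ⟨zero_le_one, le_rfl⟩ x⟩
      filter_upwards [h5.eventually hUev] with x hx
      exact hfr _ hx (mem_frontier_image_ball hinj hc ho (circleMap_mem_sphere 0 zero_le_one x))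
    exact h1.unique ((hasDerivAt_const θ (0 : ℝ)).congr_of_eventuallyEq h4)
  -- ρ ∘ F is negative inside and zero at ζ, so difference quotients along the radius from inside
  -- are positive.
  have hrad : 0 ≤ inner ℝ (gradient ρ (F ζ)) (ζ * a) := by
    have hm : MapsTo (fun r : ℝ => (r : ℂ) * ζ) (Icc 0 1) (closedBall 0 1) := by
      intro r hr
      rw [mem_closedBall_zero_iff, norm_mul, hζ1, mul_one, Complex.norm_real, Real.norm_eq_abs,
        abs_of_nonneg hr.1]
      exact hr.2
    have h2 : HasDerivWithinAt (fun r : ℝ => (r : ℂ) * ζ) ζ (Icc 0 1) 1 := by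
      simpa using ((Complex.ofRealCLM.hasDerivAt (x := 1)).mul_const ζ).hasDerivWithinAt
    have h3 := HasFDerivWithinAt.comp_hasDerivWithinAt_of_eq 1 hR h2 hm (by simp)
    rw [hL, hasDerivWithinAt_iff_tendsto_slope] at h3
    have h5 : Tendsto (fun r : ℝ => (r : ℂ) * ζ) (𝓝[Icc 0 1] 1) (𝓝[closedBall 0 1] ζ) := by
      have := h2.continuousWithinAt.tendsto_nhdsWithin hm
      simpa using this
    have hnb : (𝓝[Icc (0 : ℝ) 1 \ {1}] 1).NeBot := by
      rw [Icc_sdiff_right]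
      rw [nhdsWithin_Ico_eq_nhdsLT zero_lt_one]
      infer_instance
    refine ge_of_tendsto h3 ?_
    filter_upwards [nhdsWithin_mono _ sdiff_subset (h5.eventually hUev), self_mem_nhdsWithin]
      with r hr hr1
    have hr' : r < 1 := lt_of_le_of_ne hr1.1.2 hr1.2
    have hneg : ρ (F (r * ζ)) < 0 := by
      refine (hρD _ hr).1 (mem_image_of_mem F ?_)
      rw [mem_ball_zero_iff, norm_mul, hζ1, mul_one, Complex.norm_real, Real.norm_eq_abs,
        abs_of_nonneg hr1.1.1]
      exact hr'
    have hz0 : ρ (F ζ) = 0 := hfr _ hzU (mem_frontier_image_ball hinj hc ho hζ)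
    rw [slope_def_field]
    simp only [Function.comp_apply, Complex.ofReal_one, one_mul, hz0, sub_zero]
    exact (div_pos_of_neg_of_neg hneg (sub_neg.2 hr')).le
  have hN : gradient ρ (F ζ) ≠ 0 := by
    rw [gradient]
    simpa using hρ' _ hzU
  refine ⟨hN, ?_⟩
  set N := gradient ρ (F ζ)
  set m := ζ * a with hm
  have hm0 : m ≠ 0 := mul_ne_zero (norm_ne_zero_iff.1 (by rw [hζ1]; exact one_ne_zero)) ha
  have hmn : ‖m‖ = ‖a‖ := by rw [hm, norm_mul, hζ1, one_mul]
  rw [mul_right_comm, Complex.inner, ← hm, mul_comm] at htan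
  rw [Complex.inner, mul_comm] at hrad
  -- conj N · m is real by `htan` and nonnegative by `hrad`, so N is a nonnegative multiple of m.
  have hq : (starRingEnd ℂ) N * m = (((starRingEnd ℂ) N * m).re : ℂ) := by
    refine Complex.ext (by simp) ?_
    rw [Complex.ofReal_im]
    have : ((starRingEnd ℂ) N * (m * Complex.I)).re = -((starRingEnd ℂ) N * m).im := by
      rw [← mul_assoc, Complex.mul_I_re]
    linarith
  have hnorm : ((starRingEnd ℂ) N * m).re = ‖N‖ * ‖m‖ := by
    have := congrArg norm hq
    rw [norm_mul, RCLike.norm_conj, Complex.norm_real, Real.norm_eq_abs, abs_of_nonneg hrad] at this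
    exact this.symm
  rw [hnorm] at hq
  have hq' := congrArg (starRingEnd ℂ) hq
  rw [map_mul, Complex.conj_conj, Complex.conj_ofReal] at hq'
  have h7 : (starRingEnd ℂ) m * m = (‖m‖ : ℂ) ^ 2 := by
    rw [mul_comm, Complex.mul_conj, Complex.normSq_eq_norm_sq]; push_cast; rfl
  have hmm : (‖m‖ : ℂ) ≠ 0 := by simpa using hm0
  rw [Complex.real_smul, ← hmn]
  have : N * (‖m‖ : ℂ) ^ 2 = ‖N‖ * ‖m‖ * m := by
    rw [← h7, ← mul_assoc, hq']; push_cast; ring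
  field_simp
  have h8 : N * (‖m‖ : ℂ) * (‖m‖ : ℂ) = ‖N‖ * m * (‖m‖ : ℂ) := by linear_combination this
  exact mul_right_cancel₀ hmm h8

end Normal

/-! ### The normal derivative of the potential at the boundary. -/

section NormalDerivative

/-- The inverse of a univalent map of the closed disk is differentiable relative to the image,
also at boundary points. -/
theorem hasDerivWithinAt_invFunOn {F : ℂ → ℂ} {a ζ : ℂ} (hinj : InjOn F (closedBall 0 1))
    (hc : ContinuousOn F (closedBall 0 1)) (hζ : ζ ∈ closedBall (0 : ℂ) 1)
    (hd : HasDerivWithinAt F a (closedBall 0 1) ζ) (ha : a ≠ 0) :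
    HasDerivWithinAt (Function.invFunOn F (closedBall 0 1)) a⁻¹ (F '' closedBall 0 1) (F ζ) := by
  set J := Function.invFunOn F (closedBall 0 1) with hJ
  have hJF : ∀ w ∈ closedBall (0 : ℂ) 1, J (F w) = w := fun w hw => hinj.leftInvOn_invFunOn hw
  have hFJ : ∀ z ∈ F '' closedBall 0 1, F (J z) = z := by
    rintro _ ⟨w, hw, rfl⟩; rw [hJF w hw]
  have hJm : MapsTo J (F '' closedBall 0 1) (closedBall 0 1) := by
    rintro _ ⟨w, hw, rfl⟩; rwa [hJF w hw]
  have hJc : Tendsto J (𝓝[F '' closedBall 0 1] (F ζ)) (𝓝[closedBall 0 1] ζ) := by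
    refine tendsto_nhdsWithin_iff.2 ⟨?_, eventually_nhdsWithin_of_forall hJm⟩
    -- Continuity of the inverse by compactness: a cluster point w of J at F ζ satisfies F w = F ζ,
    -- hence w = ζ.
    refine (isCompact_closedBall (0 : ℂ) 1).tendsto_nhds_of_unique_mapClusterPt
      (eventually_nhdsWithin_of_forall hJm) fun w hw hcl => ?_
    refine hinj hw hζ ?_
    have hcl' : ClusterPt w (map J (𝓝[F '' closedBall 0 1] (F ζ)) ⊓ 𝓟 (closedBall 0 1)) := by
      have h : map J (𝓝[F '' closedBall 0 1] (F ζ)) ≤ 𝓟 (closedBall 0 1) :=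
        tendsto_principal.2 (eventually_nhdsWithin_of_forall hJm)
      rw [inf_eq_left.2 h]
      exact hcl
    have h1 : (𝓝[closedBall 0 1] w ⊓ map J (𝓝[F '' closedBall 0 1] (F ζ))).NeBot := by
      rw [nhdsWithin, inf_assoc, inf_comm (𝓟 _)]
      exact hcl'
    have h2 : Tendsto F (𝓝[closedBall 0 1] w ⊓ map J (𝓝[F '' closedBall 0 1] (F ζ)))
        (𝓝 (F w)) := (hc w hw).mono_left inf_le_left
    have h3 : Tendsto F (map J (𝓝[F '' closedBall 0 1] (F ζ))) (𝓝 (F ζ)) := by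
      rw [tendsto_map'_iff]
      refine (tendsto_id.mono_left nhdsWithin_le_nhds : Tendsto id _ (𝓝 (F ζ))).congr' ?_
      filter_upwards [self_mem_nhdsWithin] with z hz
      exact (hFJ z hz).symm
    exact tendsto_nhds_unique h2 (h3.mono_left inf_le_right)
  have hd' : HasFDerivWithinAt F ((ContinuousLinearEquiv.unitsEquivAut ℂ (Units.mk0 a ha) :
      ℂ ≃L[ℂ] ℂ) : ℂ →L[ℂ] ℂ) (closedBall 0 1) (J (F ζ)) := by
    rw [hJF ζ hζ]
    refine hd.hasFDerivWithinAt.congr_fderiv ?_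
    ext; simp
  have h := HasFDerivWithinAt.of_local_left_inverse (by rw [hJF ζ hζ]; exact hJc) hd'
    (mem_image_of_mem F hζ) (eventually_nhdsWithin_of_forall hFJ)
  have h1 := h.hasDerivWithinAt
  simpa using h1

theorem hasDerivWithinAt_log_norm_comp {J : ℝ → ℂ} {J' : ℂ} {s : Set ℝ} {x : ℝ}
    (hJ : HasDerivWithinAt J J' s x) (h0 : J x ≠ 0) :
    HasDerivWithinAt (fun y => Real.log ‖J y‖) ((J' / J x).re) s x := by
  have h1 := (hJ.norm_sq.log (pow_ne_zero 2 (norm_ne_zero_iff.2 h0))).div_const 2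
  have h2 : (J' / J x).re = 2 * inner ℝ (J x) J' / ‖J x‖ ^ 2 / 2 := by
    rw [Complex.inner, div_eq_mul_inv, Complex.inv_def, Complex.normSq_eq_norm_sq, ← mul_assoc,
      Complex.re_mul_ofReal]
    field_simp
  rw [h2]
  refine h1.congr (fun y _ => ?_) ?_ <;> · rw [Real.log_pow]; push_cast; ring

/-- On the closed domain p = -log|F⁻¹| away from 0, so the derivative along n = ζF'/|F'| is
-Re(n/(F'ζ)) = -1/|F'|. -/
theorem hasDerivWithinAt_potential_normal {D : Set ℂ} {p : ℂ → ℝ} (hp : IsPotential D p)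
    {F F1 : ℂ → ℂ} {ρ : ℂ → ℝ} {ζ n : ℂ}
    (hinj : InjOn F (closedBall 0 1)) (hc : ContinuousOn F (closedBall 0 1))
    (ho : IsOpen (F '' ball 0 1)) (hD : F '' ball 0 1 = D) (hF0 : F 0 = 0)
    (hd : ∀ z ∈ closedBall (0 : ℂ) 1, HasDerivWithinAt F (F1 z) (closedBall 0 1) z)
    (hne : ∀ z ∈ closedBall (0 : ℂ) 1, F1 z ≠ 0) (hζ : ζ ∈ sphere (0 : ℂ) 1)
    (hρ : IsDefiningFunction D (F ζ) ρ) (hρ0 : ρ (F ζ) = 0)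
    (hn : n = (‖F1 ζ‖ : ℂ)⁻¹ * (ζ * F1 ζ)) :
    HasDerivWithinAt (fun s : ℝ => p (F ζ + s • n)) (-‖F1 ζ‖⁻¹) (Iic 0) 0 := by
  have hζc := sphere_subset_closedBall hζ
  have hζ1 : ‖ζ‖ = 1 := mem_sphere_zero_iff_norm.1 hζ
  have ha := hne ζ hζc
  have hg := gradient_eq_smul hinj hc ho hD hζ (hd ζ hζc) ha hρ
  have hdb : ∀ z ∈ ball (0 : ℂ) 1, HasDerivAt F (F1 z) z := fun z hz =>
    (hd z (ball_subset_closedBall hz)).hasDerivAt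
      (mem_of_superset (isOpen_ball.mem_nhds hz) ball_subset_closedBall)
  have hneb : ∀ z ∈ ball (0 : ℂ) 1, F1 z ≠ 0 := fun z hz => hne z (ball_subset_closedBall hz)
  have hline : HasDerivAt (fun s : ℝ => F ζ + s • n) n 0 := by
    simpa using ((hasDerivAt_id (0 : ℝ)).smul_const n).const_add (F ζ)
  obtain ⟨U, hUo, hzU, hρs, hρ', hρD⟩ := hρ
  have hρd : DifferentiableAt ℝ ρ (F ζ) :=
    (hρs.differentiableOn (by simp)).differentiableAt (hUo.mem_nhds hzU)
  have hnn : ‖n‖ = 1 := by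
    rw [hn, norm_mul, norm_mul, hζ1, one_mul, norm_inv, Complex.norm_real, norm_norm,
      inv_mul_cancel₀ (norm_ne_zero_iff.2 ha)]
  have hρn : HasDerivAt (fun s : ℝ => ρ (F ζ + s • n)) ‖gradient ρ (F ζ)‖ 0 := by
    have h1 := HasFDerivAt.comp_hasDerivAt_of_eq 0 hρd.hasFDerivAt hline (by simp)
    have h2 : fderiv ℝ ρ (F ζ) n = ‖gradient ρ (F ζ)‖ := by
      have h3 : fderiv ℝ ρ (F ζ) n = inner ℝ (gradient ρ (F ζ)) n := by
        rw [gradient, InnerProductSpace.toDual_symm_apply]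
      rw [h3, hg.2, ← hn, inner_smul_left, real_inner_self_eq_norm_sq, hnn]
      rw [norm_smul, hnn]
      simp
    rw [h2] at h1
    exact h1
  -- ρ increases strictly along n, so the inner normal segment lies in D, where the inverse and the
  -- formula for p are available.
  have hin : ∀ᶠ s in 𝓝[<] (0 : ℝ), F ζ + s • n ∈ D := by
    have h1 := hρn.hasDerivWithinAt (s := Iio 0)
    rw [hasDerivWithinAt_iff_tendsto_slope' (by simp)] at h1
    have h2 : ∀ᶠ s : ℝ in 𝓝[<] 0, F ζ + s • n ∈ U :=
      (hline.continuousAt.eventually_mem (hUo.mem_nhds (by simpa using hzU))).filter_mono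
        nhdsWithin_le_nhds
    filter_upwards [h2, h1.eventually_const_lt (norm_pos_iff.2 hg.1), self_mem_nhdsWithin]
      with s hsU hs hs0
    refine (hρD _ hsU).2 ?_
    rw [slope_def_field, zero_smul, add_zero, hρ0, sub_zero, sub_zero] at hs
    by_contra! hge
    exact absurd hs (not_lt.2 (div_nonpos_of_nonneg_of_nonpos hge (le_of_lt hs0)))
  have hin' : ∀ᶠ s in 𝓝[≤] (0 : ℝ), F ζ + s • n ∈ F '' closedBall 0 1 := by
    rw [← Iio_insert, nhdsWithin_insert, eventually_sup]
    refine ⟨?_, hin.mono fun s hs => image_mono ball_subset_closedBall (hD ▸ hs)⟩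
    simpa using ⟨ζ, mem_closedBall_zero_iff.1 hζc, rfl⟩
  obtain ⟨V, hV, hVm⟩ := eventually_iff_exists_mem.1 hin'
  set J := Function.invFunOn F (closedBall 0 1)
  have hJF : ∀ w ∈ closedBall (0 : ℂ) 1, J (F w) = w := fun w hw => hinj.leftInvOn_invFunOn hw
  have hJ := hasDerivWithinAt_invFunOn hinj hc hζc (hd ζ hζc) ha
  have hJs : HasDerivWithinAt (fun s : ℝ => J (F ζ + s • n)) (n * (F1 ζ)⁻¹) (V ∩ Iic 0) 0 := by
    have := HasDerivWithinAt.scomp_of_eq (0 : ℝ) hJ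
      (hline.hasDerivWithinAt (s := V ∩ Iic 0)) (fun s hs => hVm s hs.1) (by simp)
    simpa [J, Function.comp_def] using this
  have hJ0 : J (F ζ + (0 : ℝ) • n) = ζ := by rw [zero_smul, add_zero, hJF ζ hζc]
  have hζ0 : ζ ≠ 0 := norm_ne_zero_iff.1 (by rw [hζ1]; exact one_ne_zero)
  have hlog := (hasDerivWithinAt_log_norm_comp hJs (by rw [hJ0]; exact hζ0)).neg
  have hval : (n * (F1 ζ)⁻¹ / J (F ζ + (0 : ℝ) • n)).re = ‖F1 ζ‖⁻¹ := by
    rw [hJ0, hn]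
    have : (‖F1 ζ‖ : ℂ)⁻¹ * (ζ * F1 ζ) * (F1 ζ)⁻¹ / ζ = ((‖F1 ζ‖⁻¹ : ℝ) : ℂ) := by
      push_cast
      field_simp
    rw [this, Complex.ofReal_re]
  rw [hval] at hlog
  -- Localize to where the segment meets the image and avoids the pole of p, the image of the disk's
  -- center.
  have hFc := hasDerivWithinAt_inter' (f := fun s : ℝ => p (F ζ + s • n)) (f' := -‖F1 ζ‖⁻¹)
    (s := Iic 0) (t := V ∩ {s : ℝ | J (F ζ + s • n) ≠ 0}) (x := 0) ?_
  · refine hFc.1 (HasDerivWithinAt.congr (hlog.mono ?_) ?_ ?_)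
    · exact fun s hs => ⟨hs.2.1, hs.1⟩
    · intro s hs
      obtain ⟨w, hw, hws⟩ := hVm s hs.2.1
      have hJw := hJF w hw
      rw [hws] at hJw
      have h3 := hs.2.2
      rw [mem_ofPred_eq, hJw] at h3
      simp only [Pi.neg_apply]
      rw [hJw, ← hws, potential_comp_eq hp hinj hc ho hD hF0 hdb hneb hw h3]
    · simp only [Pi.neg_apply]
      rw [hJ0, zero_smul, add_zero, potential_comp_eq hp hinj hc ho hD hF0 hdb hneb hζc hζ0]
  · refine inter_mem hV ?_
    have hcw := hJs.continuousWithinAt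
    have h4 : ∀ᶠ s in 𝓝[V ∩ Iic 0] (0 : ℝ), J (F ζ + s • n) ≠ 0 :=
      hcw.eventually_ne (by simp only [hJ0]; exact hζ0)
    rwa [nhdsWithin_inter_of_mem hV] at h4

end NormalDerivative

/-! ### The boundary equation of the conformal map. -/

section PolubarinovaGalin

/-- The Polubarinova–Galin equation `Re (conj (∂f/∂t) ζ f') = 1` on the unit circle. -/
theorem re_conj_mul_eq_one {T : ℝ} {Ω : ℝ → Set ℂ} {p : ℝ → ℂ → ℝ} {f f1 : ℝ → ℂ → ℂ}
    (hΩ : IsStrongSolution T Ω p) (himage : ∀ t ∈ Ico 0 T, f t '' ball 0 1 = Ω t)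
    (hzero : ∀ t ∈ Ico 0 T, f t 0 = 0)
    (hinj : ∀ t ∈ Ico 0 T, InjOn (f t) (closedBall 0 1))
    (hd : ∀ t ∈ Ico 0 T, ∀ z ∈ closedBall (0 : ℂ) 1,
      HasDerivWithinAt (f t) (f1 t z) (closedBall 0 1) z)
    (hne : ∀ t ∈ Ico 0 T, ∀ z ∈ closedBall (0 : ℂ) 1, f1 t z ≠ 0)
    {t : ℝ} (ht : t ∈ Ico 0 T) {ζ : ℂ} (hζ : ζ ∈ sphere (0 : ℂ) 1) {g : ℂ}
    (hg : HasDerivWithinAt (fun s => f s ζ) g (Ico 0 T) t) :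
    ((starRingEnd ℂ) g * (ζ * f1 t ζ)).re = 1 := by
  have hc : ∀ t ∈ Ico 0 T, ContinuousOn (f t) (closedBall 0 1) := fun t ht z hz =>
    (hd t ht z hz).continuousWithinAt
  have ho : ∀ t ∈ Ico 0 T, IsOpen (f t '' ball 0 1) := fun t ht =>
    (himage t ht).symm ▸ hΩ.isOpen t ht
  have hfr : ∀ t ∈ Ico 0 T, f t ζ ∈ frontier (Ω t) := fun t ht =>
    himage t ht ▸ mem_frontier_image_ball (hinj t ht) (hc t ht) (ho t ht) hζ
  have hζc := sphere_subset_closedBall hζ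
  have ha := hne t ht ζ hζc
  obtain ⟨ρ, hρ, hρ0⟩ := hΩ.smooth t ht _ (hfr t ht)
  have hgr := gradient_eq_smul (hinj t ht) (hc t ht) (ho t ht) (himage t ht) hζ
    (hd t ht ζ hζc) ha hρ
  have hnn : ‖(‖f1 t ζ‖ : ℂ)⁻¹ * (ζ * f1 t ζ)‖ = 1 := by
    rw [norm_mul, norm_mul, mem_sphere_zero_iff_norm.1 hζ, one_mul, norm_inv, Complex.norm_real,
      norm_norm, inv_mul_cancel₀ (norm_ne_zero_iff.2 ha)]
  obtain ⟨v, ⟨_, hv⟩, hvp⟩ := hΩ.kinematic t ht _ (hfr t ht) _ ⟨hnn, ρ, hρ, hρ0, hgr.2⟩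
  -- The trajectory of a fixed ζ follows the moving boundary, so its velocity g has normal component
  -- v; comparing one-sided derivatives of p then gives v = 1/|f'|.
  have h1 := hv (fun s => f s ζ) g ⟨rfl, eventually_nhdsWithin_of_forall hfr, hg⟩
  have h2 := hasDerivWithinAt_potential_normal (hΩ.potential t ht) (hinj t ht) (hc t ht) (ho t ht)
    (himage t ht) (hzero t ht) (hd t ht) (hne t ht) hζ hρ hρ0 rfl
  have h3 := (uniqueDiffWithinAt_Iic 0).eq_deriv _ hvp h2
  rw [neg_inj] at h3
  rw [h3, Complex.inner, ← Complex.ofReal_inv, mul_assoc, Complex.re_ofReal_mul] at h1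
  have h4 := mul_left_cancel₀ (inv_ne_zero (norm_ne_zero_iff.2 ha)) (h1.trans (mul_one _).symm)
  rwa [mul_comm] at h4

end PolubarinovaGalin

/-! ### Assembling the two derivative formulas. -/

section Main

/-- Makes derivatives relative to the closed disk well defined on the circle; real unique
differentiability follows from convexity and passes to the larger field. -/
theorem uniqueDiffOn_complex_closedBall : UniqueDiffOn ℂ (closedBall (0 : ℂ) 1) := fun z hz =>
  (uniqueDiffOn_convex (convex_closedBall (0 : ℂ) 1)
    ⟨0, by rw [interior_closedBall _ one_ne_zero]; exact mem_ball_self one_pos⟩ z hz).mono_field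

theorem hasDerivWithinAt_dζ {F : ℂ → ℂ} (hF : ContDiffOn ℂ ∞ F (closedBall 0 1)) (k : ℕ) {z : ℂ}
    (hz : z ∈ closedBall (0 : ℂ) 1) :
    HasDerivWithinAt (dζ k F) (dζ (k + 1) F z) (closedBall 0 1) z := by
  have h := (hF.differentiableOn_iteratedDerivWithin (m := k)
    (by exact_mod_cast ENat.natCast_lt_top k) uniqueDiffOn_complex_closedBall z hz).hasDerivWithinAt
  rw [← iteratedDerivWithin_succ] at h
  exact h

theorem hasDerivAt_dζ {F : ℂ → ℂ} (hF : ContDiffOn ℂ ∞ F (closedBall 0 1)) (k : ℕ) {z : ℂ}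
    (hz : z ∈ ball (0 : ℂ) 1) : HasDerivAt (dζ k F) (dζ (k + 1) F z) z :=
  (hasDerivWithinAt_dζ hF k (ball_subset_closedBall hz)).hasDerivAt
    (mem_of_superset (isOpen_ball.mem_nhds hz) ball_subset_closedBall)

theorem dζ_zero (F : ℂ → ℂ) : dζ 0 F = F := iteratedDerivWithin_zero

theorem circlePt_eq_circleMap (θ : ℝ) : circlePt θ = circleMap 0 1 θ := by
  simp [circlePt, circleMap]

/-- The logarithmic derivative `F'' / F'` of the derivative. -/
def preSchwarzian (F : ℂ → ℂ) (z : ℂ) : ℂ := dζ 2 F z / dζ 1 F z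

/-- The derivative of `preSchwarzian`. -/
def preSchwarzianDeriv (F : ℂ → ℂ) (z : ℂ) : ℂ :=
  dζ 3 F z / dζ 1 F z - (dζ 2 F z / dζ 1 F z) ^ 2

theorem hasDerivAt_preSchwarzian {F : ℂ → ℂ} (hF : ContDiffOn ℂ ∞ F (closedBall 0 1)) {z : ℂ}
    (hz : z ∈ ball (0 : ℂ) 1) (hne : dζ 1 F z ≠ 0) :
    HasDerivAt (preSchwarzian F) (preSchwarzianDeriv F z) z := by
  refine ((hasDerivAt_dζ hF 2 hz).fun_div (hasDerivAt_dζ hF 1 hz) hne).congr_deriv ?_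
  rw [preSchwarzianDeriv]
  norm_num
  field_simp

/-- A function on the closed disk vanishing at the origin, divided by the variable, has vanishing
mean against functions vanishing at the origin. -/
theorem integral_circle_div_mul {Q B : ℂ → ℂ} (hQ : ContinuousOn Q (closedBall 0 1))
    (hQd : DifferentiableOn ℂ Q (ball 0 1)) (hQ0 : Q 0 = 0) (hB : ContinuousOn B (closedBall 0 1))
    (hBd : DifferentiableOn ℂ B (ball 0 1)) :
    ∫ θ in (0 : ℝ)..2 * π, Q (circleMap 0 1 θ) / circleMap 0 1 θ * B (circleMap 0 1 θ) =
      2 * π * (deriv Q 0 * B 0) := by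
  have h0b : ball (0 : ℂ) 1 ∈ 𝓝 0 := isOpen_ball.mem_nhds (mem_ball_self one_pos)
  have h0c : closedBall (0 : ℂ) 1 ∈ 𝓝 0 := mem_of_superset h0b ball_subset_closedBall
  -- `dslope Q 0` is the continuous extension of Q(z)/z, holomorphic in the ball, and the mean value
  -- property applies to its product with B.
  have hA : ContinuousOn (dslope Q 0) (closedBall 0 1) :=
    (continuousOn_dslope h0c).2 ⟨hQ, hQd.differentiableAt h0b⟩
  have hAd : DifferentiableOn ℂ (dslope Q 0) (ball 0 1) :=
    (Complex.differentiableOn_dslope h0b).2 hQd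
  have h := integral_circleMap_of_differentiableAt (A := fun z => dslope Q 0 z * B z)
    countable_empty (hA.mul hB)
    (fun z hz => (hAd.fun_mul hBd).differentiableAt (isOpen_ball.mem_nhds hz.1))
  simp only [dslope_same] at h
  rw [← h]
  refine intervalIntegral.integral_congr fun θ _ => ?_
  have hz : circleMap 0 1 θ ≠ 0 := circleMap_ne_center one_ne_zero
  rw [dslope_of_ne _ hz, slope_def_field, hQ0, sub_zero, sub_zero]

theorem re_div_of_re_conj_mul {g a z : ℂ} (hz : ‖z‖ = 1)
    (h : ((starRingEnd ℂ) g * (z * a)).re = 1) : (g / a / z).re = 1 / ‖a‖ ^ 2 := by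
  have h1 : g / a / z = g * (starRingEnd ℂ) (z * a) * ((‖a‖ ^ 2)⁻¹ : ℝ) := by
    rw [div_div, div_eq_mul_inv, Complex.inv_def, Complex.normSq_eq_norm_sq, norm_mul, hz,
      mul_one, mul_comm a z, mul_assoc]
  have h2 : (g * (starRingEnd ℂ) (z * a)).re = 1 := by
    rw [← h, ← Complex.conj_re, map_mul, Complex.conj_conj]
  rw [h1, Complex.re_mul_ofReal, h2, one_mul, one_div]

/-- The pointwise identity between the integrands of the two forms of the variation. -/
theorem variation_integrand_eq {Q h h' z : ℂ} {m : ℝ} (hz : ‖z‖ = 1) (hQ : (Q / z).re = 1 / m ^ 2) :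
    (Q * ((((1 : ℝ) : ℂ) ^ 2)⁻¹ * (starRingEnd ℂ) (2 * z ^ 2 * h + z ^ 3 * h') +
      h * (starRingEnd ℂ) (z * h))).re + 2 * (1 / m ^ 2) =
    2 * ((1 + z * h).re / m) ^ 2 + 2 / m ^ 2 * (z ^ 2 * (h' - 1 / 2 * h ^ 2)).re -
      (Q / z * (2 * z * h + z ^ 2 * h')).re := by
  have hzz : z * (starRingEnd ℂ) z = 1 := by
    rw [Complex.mul_conj, Complex.normSq_eq_norm_sq, hz]; simp
  have hz0 : z ≠ 0 := norm_ne_zero_iff.1 (by rw [hz]; exact one_ne_zero)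
  -- In terms of q = Q/z, a = zh, b = z²h', using |z| = 1, the claim is Re(q conj w) + Re(q w) = 2
  -- Re q Re w for w = 2a + b, plus 2(Re a)² - Re(a²) = |a|².
  obtain ⟨q, hq⟩ : ∃ q, q = Q / z := ⟨_, rfl⟩
  have hQq : Q = q * z := by rw [hq]; field_simp
  obtain ⟨a, ha⟩ : ∃ a, a = z * h := ⟨_, rfl⟩
  obtain ⟨b, hb⟩ : ∃ b, b = z ^ 2 * h' := ⟨_, rfl⟩
  have e1 : Q * ((((1 : ℝ) : ℂ) ^ 2)⁻¹ * (starRingEnd ℂ) (2 * z ^ 2 * h + z ^ 3 * h') +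
      h * (starRingEnd ℂ) (z * h)) =
      q * (starRingEnd ℂ) (2 * a + b) + q * (a * (starRingEnd ℂ) a) := by
    have e2 : 2 * z ^ 2 * h + z ^ 3 * h' = z * (2 * a + b) := by rw [ha, hb]; ring
    rw [e2, hQq, map_mul, ← ha]
    rw [Complex.ofReal_one, one_pow, inv_one, one_mul]
    linear_combination q * (starRingEnd ℂ) (2 * a + b) * hzz - q * (starRingEnd ℂ) a * ha
  have e3 : 2 * z * h + z ^ 2 * h' = 2 * a + b := by rw [ha, hb]; ring
  have e4 : z ^ 2 * (h' - 1 / 2 * h ^ 2) = b - 1 / 2 * a ^ 2 := by rw [ha, hb]; ring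
  rw [e1, e3, e4, ← hq, ← ha]
  rw [← hq] at hQ
  have hm : ((1 + a).re / m) ^ 2 = (1 + a).re ^ 2 * (1 / m ^ 2) := by
    rw [div_pow]; ring
  have hm2 : 2 / m ^ 2 = 2 * (1 / m ^ 2) := by ring
  rw [hm, hm2, ← hQ]
  simp [pow_two]
  ring

/-- For integrands that agree only up to a discrepancy E of zero integral. -/
theorem integral_add_eq_integral_add_of_sub {A B C D E : ℝ → ℝ} {a b : ℝ} (hA : Continuous A)
    (hB : Continuous B) (hC : Continuous C) (hD : Continuous D) (hE : Continuous E)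
    (h : ∀ x, A x + B x = C x + D x - E x) (h0 : ∫ x in a..b, E x = 0) :
    (∫ x in a..b, A x) + ∫ x in a..b, B x = (∫ x in a..b, C x) + ∫ x in a..b, D x := by
  rw [← intervalIntegral.integral_add (hA.intervalIntegrable _ _) (hB.intervalIntegrable _ _),
    ← intervalIntegral.integral_add (hC.intervalIntegrable _ _) (hD.intervalIntegrable _ _),
    ← sub_zero (∫ x in a..b, C x + D x), ← h0, ← intervalIntegral.integral_sub
      ((hC.fun_add hD).intervalIntegrable _ _) (hE.intervalIntegrable _ _)]
  exact intervalIntegral.integral_congr fun x _ => h x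

theorem logAction_eq {T : ℝ} {Ω : ℝ → Set ℂ} {f : ℝ → ℂ → ℂ} (hf : IsParametricFunction T Ω f)
    {t : ℝ} (ht : t ∈ Ico 0 T) :
    Tendsto (regularizedAction (f t)) (𝓝[>] 0) (𝓝 (logAction (f t))) ∧
      logAction (f t) = diskIntegral (preSchwarzian (f t)) 1 + energy (f t) := by
  have hsm := hf.smooth t ht
  have hne := hf.deriv_ne_zero t ht
  have hcd : ∀ k, ContinuousOn (dζ k (f t)) (closedBall 0 1) := fun k z hz =>
    (hasDerivWithinAt_dζ hsm k hz).continuousWithinAt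
  have h := tendsto_regularizedAction (hf.injOn t ht) (hf.zero t ht) hsm.continuousOn
    (F1 := dζ 1 (f t)) (F2 := dζ 2 (f t))
    (fun z hz => by simpa only [dζ_zero] using hasDerivAt_dζ hsm 0 hz)
    (fun z hz => hasDerivAt_dζ hsm 1 hz) (fun z hz => hne z (ball_subset_closedBall hz))
    ((hcd 2).div (hcd 1) hne)
    (fun z hz => (hasDerivAt_preSchwarzian hsm hz
      (hne z (ball_subset_closedBall hz))).differentiableAt.differentiableWithinAt)
  have he : logAction (f t) = diskIntegral (preSchwarzian (f t)) 1 + energy (f t) := h.limUnder_eq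
  exact ⟨he ▸ h, he⟩

/-- Both formulas rest on Re(Q/ζ) = 1/|f'|² with Q/ζ holomorphic. The subtracted integral in the
second is twice the energy derivative, ready to cancel. -/
theorem hasDerivWithinAt_energy_and_diskIntegral {T : ℝ} {Ω : ℝ → Set ℂ} {p : ℝ → ℂ → ℝ}
    {f : ℝ → ℂ → ℂ} (hΩ : IsStrongSolution T Ω p) (hf : IsParametricFunction T Ω f)
    {t : ℝ} (ht : t ∈ Ico 0 T) :
    HasDerivWithinAt (fun s => energy (f s))
      (∫ θ in (0 : ℝ)..2 * π, 1 / ‖dζ 1 (f t) (circlePt θ)‖ ^ 2) (Ico 0 T) t ∧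
    HasDerivWithinAt (fun s => diskIntegral (preSchwarzian (f s)) 1)
      (2 * (∫ θ in (0 : ℝ)..2 * π, curvature (f t) (circlePt θ) ^ 2) +
        (∫ θ in (0 : ℝ)..2 * π, 2 / ‖dζ 1 (f t) (circlePt θ)‖ ^ 2 *
          (Complex.exp (2 * θ * Complex.I) * schwarzian (f t) (circlePt θ)).re) -
        2 * ∫ θ in (0 : ℝ)..2 * π, 1 / ‖dζ 1 (f t) (circlePt θ)‖ ^ 2) (Ico 0 T) t := by
  obtain ⟨g, hg, hgc⟩ := hf.time_deriv
  have hI : Convex ℝ (Ico 0 T) := convex_Ico 0 T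
  have hIu : UniqueDiffOn ℝ (Ico 0 T) := uniqueDiffOn_Ico 0 T
  have hbc : ball (0 : ℂ) 1 ⊆ closedBall 0 1 := ball_subset_closedBall
  have hprod : Ico 0 T ×ˢ ball (0 : ℂ) 1 ⊆ Ico 0 T ×ˢ closedBall 0 1 := prod_mono le_rfl hbc
  have hfd : ∀ s ∈ Ico 0 T, ∀ k, ∀ z ∈ ball (0 : ℂ) 1,
      HasDerivAt (dζ k (f s)) (dζ (k + 1) (f s) z) z := fun s hs k z hz =>
    hasDerivAt_dζ (hf.smooth s hs) k hz
  have hdiff : ∀ s ∈ Ico 0 T, ∀ k, DifferentiableOn ℂ (dζ k (f s)) (ball 0 1) := fun s hs k z hz =>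
    (hfd s hs k z hz).differentiableAt.differentiableWithinAt
  have hne := hf.deriv_ne_zero
  have hneb : ∀ s ∈ Ico 0 T, ∀ z ∈ ball (0 : ℂ) 1, dζ 1 (f s) z ≠ 0 := fun s hs z hz =>
    hne s hs z (hbc hz)
  have hsec : ∀ {A : ℝ → ℂ → ℂ}, ContinuousOn (fun q : ℝ × ℂ => A q.1 q.2)
      (Ico 0 T ×ˢ closedBall 0 1) → ∀ s ∈ Ico 0 T, ContinuousOn (A s) (closedBall 0 1) :=
    fun hA s hs => hA.comp (f := fun z => (s, z)) (by fun_prop) fun z hz => ⟨hs, hz⟩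
  -- Time and space derivatives are interchanged here and once more for `ht2`, but only in the open
  -- ball, where g is holomorphic.
  have hg0 := fun s (hs : s ∈ Ico 0 T) => hasDerivWithinAt_deriv_of_holomorphic hI hIu isOpen_ball
    (F := fun s => dζ 0 (f s)) (G := g) (fun s hs => hdiff s hs 0)
    (fun s hs z hz => by simpa only [dζ_zero] using hg s hs z (hbc hz)) (hgc.mono hprod) hs
  have hgd : ∀ s ∈ Ico 0 T, DifferentiableOn ℂ (g s) (ball 0 1) := fun s hs => (hg0 s hs).1
  have hg1c := continuousOn_deriv_of_holomorphic isOpen_ball hgd (hgc.mono hprod)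
  have ht1 : ∀ s ∈ Ico 0 T, ∀ z ∈ ball (0 : ℂ) 1,
      HasDerivWithinAt (fun s => dζ 1 (f s) z) (deriv (g s) z) (Ico 0 T) s := fun s hs z hz =>
    ((hg0 s hs).2 z hz).congr (fun r hr => (hfd r hr 0 z hz).deriv.symm)
      (hfd s hs 0 z hz).deriv.symm
  have hgd1 : ∀ s ∈ Ico 0 T, DifferentiableOn ℂ (deriv (g s)) (ball 0 1) := fun s hs =>
    (hgd s hs).deriv isOpen_ball
  have hg2c := continuousOn_deriv_of_holomorphic isOpen_ball hgd1 hg1c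
  have ht2 : ∀ s ∈ Ico 0 T, ∀ z ∈ ball (0 : ℂ) 1,
      HasDerivWithinAt (fun s => dζ 2 (f s) z) (deriv (deriv (g s)) z) (Ico 0 T) s :=
    fun s hs z hz =>
    ((hasDerivWithinAt_deriv_of_holomorphic hI hIu isOpen_ball (F := fun s => dζ 1 (f s))
      (G := fun s => deriv (g s)) (fun s hs => hdiff s hs 1) ht1 hg1c hs).2 z hz).congr
      (fun r hr => (hfd r hr 1 z hz).deriv.symm) (hfd s hs 1 z hz).deriv.symm
  have hcont := hf.continuousOn
  have hne' : ∀ q ∈ Ico 0 T ×ˢ closedBall (0 : ℂ) 1, dζ 1 (f q.1) q.2 ≠ 0 := fun q hq =>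
    hne q.1 hq.1 q.2 hq.2
  have hhc : ContinuousOn (fun q : ℝ × ℂ => preSchwarzian (f q.1) q.2)
      (Ico 0 T ×ˢ closedBall 0 1) := (hcont 2).div (hcont 1) hne'
  have hh'c : ContinuousOn (fun q : ℝ × ℂ => preSchwarzianDeriv (f q.1) q.2)
      (Ico 0 T ×ˢ closedBall 0 1) := ((hcont 3).div (hcont 1) hne').sub (hhc.pow 2)
  have hQc : ContinuousOn (fun q : ℝ × ℂ => g q.1 q.2 / dζ 1 (f q.1) q.2)
      (Ico 0 T ×ˢ closedBall 0 1) := hgc.div (hcont 1) hne'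
  have hgD : ∀ s ∈ Ico 0 T, ∀ z ∈ ball (0 : ℂ) 1, HasDerivAt (g s) (deriv (g s) z) z :=
    fun s hs z hz => ((hgd s hs).differentiableAt (isOpen_ball.mem_nhds hz)).hasDerivAt
  have hgD1 : ∀ s ∈ Ico 0 T, ∀ z ∈ ball (0 : ℂ) 1,
      HasDerivAt (deriv (g s)) (deriv (deriv (g s)) z) z :=
    fun s hs z hz => ((hgd1 s hs).differentiableAt (isOpen_ball.mem_nhds hz)).hasDerivAt
  have hQD : ∀ s ∈ Ico 0 T, ∀ z ∈ ball (0 : ℂ) 1, HasDerivAt (fun z => g s z / dζ 1 (f s) z)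
      (deriv (g s) z / dζ 1 (f s) z - g s z / dζ 1 (f s) z * preSchwarzian (f s) z) z := by
    intro s hs z hz
    have h0 := hneb s hs z hz
    refine ((hgD s hs z hz).fun_div (hfd s hs 1 z hz) h0).congr_deriv ?_
    rw [preSchwarzian]
    norm_num
    field_simp
  have hvar := hasDerivWithinAt_diskIntegral_one hI
    (Q := fun s z => g s z / dζ 1 (f s) z) (V := fun s z => deriv (g s) z / dζ 1 (f s) z)
    (W := fun s z => (deriv (deriv (g s)) z * dζ 1 (f s) z - deriv (g s) z * dζ 2 (f s) z) /
      dζ 1 (f s) z ^ 2)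
    (h := fun s => preSchwarzian (f s)) (h' := fun s => preSchwarzianDeriv (f s))
    (fun s hs z hz => (hgD1 s hs z hz).fun_div (hfd s hs 1 z hz) (hneb s hs z hz))
    hQD (fun s hs z hz => hasDerivAt_preSchwarzian (hf.smooth s hs) hz (hneb s hs z hz))
    (fun s hs z hz => ((ht2 s hs z hz).fun_div (ht1 s hs z hz) (hneb s hs z hz)).congr_deriv
      (by ring))
    (((hg2c.mul ((hcont 1).mono hprod)).sub (hg1c.mul ((hcont 2).mono hprod))).div
      (((hcont 1).mono hprod).pow 2) fun q hq => pow_ne_zero 2 (hne' q (hprod hq)))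
    hQc hhc hh'c ht
  have h0b : (0 : ℂ) ∈ ball (0 : ℂ) 1 := mem_ball_self one_pos
  -- The normalization f(0, t) = 0 makes g vanish at 0, so Q/ζ has a removable singularity.
  have hg00 : g t 0 = 0 := by
    have h1 := hg t ht 0 (hbc h0b)
    have h2 : HasDerivWithinAt (fun s => f s 0) 0 (Ico 0 T) t :=
      (hasDerivWithinAt_const t (Ico 0 T) (0 : ℂ)).congr (fun s hs => hf.zero s hs) (hf.zero t ht)
    exact (hIu t ht).eq_deriv _ h1 h2
  set Q : ℂ → ℂ := fun z => g t z / dζ 1 (f t) z with hQdef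
  have hQ0 : Q 0 = 0 := by simp only [hQdef, hg00, zero_div]
  have hQct : ContinuousOn Q (closedBall 0 1) := hsec (A := fun s z => g s z / dζ 1 (f s) z) hQc t ht
  have hQdt : DifferentiableOn ℂ Q (ball 0 1) := fun z hz =>
    (hQD t ht z hz).differentiableAt.differentiableWithinAt
  have hPG : ∀ θ : ℝ, (Q (circleMap 0 1 θ) / circleMap 0 1 θ).re =
      1 / ‖dζ 1 (f t) (circleMap 0 1 θ)‖ ^ 2 := by
    intro θ
    have hs : circleMap 0 1 θ ∈ sphere (0 : ℂ) 1 := circleMap_mem_sphere 0 zero_le_one θ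
    refine re_div_of_re_conj_mul (mem_sphere_zero_iff_norm.1 hs) ?_
    exact re_conj_mul_eq_one hΩ hf.image hf.zero hf.injOn (f1 := fun s => dζ 1 (f s))
      (fun s hs z hz => by simpa only [dζ_zero] using hasDerivWithinAt_dζ (hf.smooth s hs) 0 hz)
      hne ht hs (hg t ht _ (sphere_subset_closedBall hs))
  have hcirc : ∀ {A : ℂ → ℂ}, ContinuousOn A (closedBall 0 1) →
      Continuous fun θ : ℝ => A (circleMap 0 1 θ) := fun hA =>
    hA.comp_continuous (continuous_circleMap 0 1)
      fun θ => sphere_subset_closedBall (circleMap_mem_sphere 0 zero_le_one θ)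
  have cz := continuous_circleMap 0 1
  have hz0 : ∀ θ : ℝ, circleMap (0 : ℂ) 1 θ ≠ 0 := fun θ => circleMap_ne_center one_ne_zero
  have cq : Continuous fun θ : ℝ => Q (circleMap 0 1 θ) / circleMap 0 1 θ :=
    (hcirc hQct).div cz hz0
  have ch := hcirc (hsec (A := fun s => preSchwarzian (f s)) hhc t ht)
  have ch' := hcirc (hsec (A := fun s => preSchwarzianDeriv (f s)) hh'c t ht)
  have c1 := hcirc (hsec (A := fun s => dζ 1 (f s)) (hcont 1) t ht)
  have c1n : ∀ θ : ℝ, ‖dζ 1 (f t) (circleMap 0 1 θ)‖ ≠ 0 := fun θ =>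
    norm_ne_zero_iff.2 (hne t ht _ (sphere_subset_closedBall (circleMap_mem_sphere 0 zero_le_one θ)))
  have cμ : Continuous fun θ : ℝ => 1 / ‖dζ 1 (f t) (circleMap 0 1 θ)‖ ^ 2 :=
    continuous_const.div (c1.norm.pow 2) fun θ => pow_ne_zero 2 (c1n θ)
  have hmean : ∫ θ in (0 : ℝ)..2 * π, 1 / ‖dζ 1 (f t) (circleMap 0 1 θ)‖ ^ 2 =
      2 * π * (deriv (g t) 0 / dζ 1 (f t) 0).re := by
    -- With B = 1 the mean of Q/ζ is Q'(0) = g'(0)/f'(0), the logarithmic time derivative of f'(0).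
    have h1 := integral_circle_div_mul hQct hQdt hQ0 (B := fun _ => 1) continuousOn_const
      (differentiableOn_const 1)
    simp only [mul_one] at h1
    rw [(hQD t ht 0 h0b).deriv, hg00, zero_div, zero_mul, sub_zero] at h1
    have h2 := congrArg Complex.re h1
    rw [intervalIntegral_re (cq.intervalIntegrable _ _), ← Complex.ofReal_ofNat,
      ← Complex.ofReal_mul, Complex.re_ofReal_mul] at h2
    rw [← h2]
    exact intervalIntegral.integral_congr fun θ _ => (hPG θ).symm
  simp only [circlePt_eq_circleMap]
  refine ⟨?_, ?_⟩
  · rw [hmean]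
    exact (hasDerivWithinAt_log_norm_comp (ht1 t ht 0 h0b) (hneb t ht 0 h0b)).const_mul (2 * π)
  · refine hvar.congr_deriv ?_
    -- This B vanishes at 0, so the holomorphic remainder of the pointwise identity integrates to
    -- zero.
    have hB := integral_circle_div_mul hQct hQdt hQ0
      (B := fun z => 2 * z * preSchwarzian (f t) z + z ^ 2 * preSchwarzianDeriv (f t) z)
      (((continuousOn_const.mul continuousOn_id).mul
        (hsec (A := fun s => preSchwarzian (f s)) hhc t ht)).add
        ((continuousOn_id.pow 2).mul (hsec (A := fun s => preSchwarzianDeriv (f s)) hh'c t ht)))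
      (by
        have d1 : DifferentiableOn ℂ (preSchwarzian (f t)) (ball 0 1) :=
          (hdiff t ht 2).fun_div (hdiff t ht 1) (hneb t ht)
        have d2 : DifferentiableOn ℂ (preSchwarzianDeriv (f t)) (ball 0 1) :=
          ((hdiff t ht 3).fun_div (hdiff t ht 1) (hneb t ht)).fun_sub (d1.fun_pow 2)
        fun_prop)
    have hB' : ∫ θ in (0 : ℝ)..2 * π, (Q (circleMap 0 1 θ) / circleMap 0 1 θ *
        (2 * circleMap 0 1 θ * preSchwarzian (f t) (circleMap 0 1 θ) +
          circleMap 0 1 θ ^ 2 * preSchwarzianDeriv (f t) (circleMap 0 1 θ))).re = 0 := by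
      rw [← intervalIntegral_re, hB]
      · simp
      · exact (cq.mul (((continuous_const.mul cz).mul ch).add
          ((cz.pow 2).mul ch'))).intervalIntegrable _ _
    have cj := Complex.continuous_conj
    have cre := Complex.continuous_re
    have cS : Continuous fun θ : ℝ => schwarzian (f t) (circleMap 0 1 θ) := by
      have : ∀ θ : ℝ, schwarzian (f t) (circleMap 0 1 θ) =
          preSchwarzianDeriv (f t) (circleMap 0 1 θ) -
            1 / 2 * preSchwarzian (f t) (circleMap 0 1 θ) ^ 2 := fun θ => by
        rw [schwarzian, preSchwarzian, preSchwarzianDeriv]; ring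
      simp only [this]
      exact ch'.sub (continuous_const.mul (ch.pow 2))
    have cκ : Continuous fun θ : ℝ => curvature (f t) (circleMap 0 1 θ) ^ 2 := by
      refine Continuous.pow (Continuous.div (cre.comp ?_) c1.norm c1n) 2
      have : ∀ θ : ℝ, 1 + circleMap 0 1 θ * dζ 2 (f t) (circleMap 0 1 θ) /
          dζ 1 (f t) (circleMap 0 1 θ) =
          1 + circleMap 0 1 θ * preSchwarzian (f t) (circleMap 0 1 θ) := fun θ => by
        rw [preSchwarzian, mul_div_assoc]
      simp only [this]
      exact continuous_const.add (cz.mul ch)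
    have hexp : ∀ θ : ℝ, Complex.exp (2 * θ * Complex.I) = circleMap 0 1 θ ^ 2 := by
      intro θ
      rw [circleMap_zero, Complex.ofReal_one, one_mul, ← Complex.exp_nat_mul]
      push_cast
      ring_nf
    simp only [hexp]
    have cT : Continuous fun θ : ℝ => 2 / ‖dζ 1 (f t) (circleMap 0 1 θ)‖ ^ 2 *
        (circleMap 0 1 θ ^ 2 * schwarzian (f t) (circleMap 0 1 θ)).re :=
      (continuous_const.div (c1.norm.pow 2) fun θ => pow_ne_zero 2 (c1n θ)).mul
        (cre.comp ((cz.pow 2).mul cS))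
    have cG : Continuous fun θ : ℝ => Q (circleMap 0 1 θ) *
        ((((1 : ℝ) : ℂ) ^ 2)⁻¹ * (starRingEnd ℂ)
          (2 * circleMap 0 1 θ ^ 2 * preSchwarzian (f t) (circleMap 0 1 θ) +
            circleMap 0 1 θ ^ 3 * preSchwarzianDeriv (f t) (circleMap 0 1 θ)) +
          preSchwarzian (f t) (circleMap 0 1 θ) * (starRingEnd ℂ)
            (circleMap 0 1 θ * preSchwarzian (f t) (circleMap 0 1 θ))) :=
      (hcirc hQct).mul ((continuous_const.mul (cj.comp (((continuous_const.mul (cz.pow 2)).mul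
        ch).add ((cz.pow 3).mul ch')))).add (ch.mul (cj.comp (cz.mul ch))))
    rw [eq_sub_iff_add_eq, boundaryVariation, intervalIntegral_re (cG.intervalIntegrable _ _),
      ← intervalIntegral.integral_const_mul, ← intervalIntegral.integral_const_mul]
    refine integral_add_eq_integral_add_of_sub (cre.comp cG) (continuous_const.mul cμ)
      (continuous_const.mul cκ) cT (cre.comp (cq.mul (((continuous_const.mul cz).mul ch).add
        ((cz.pow 2).mul ch')))) (fun θ => ?_) hB'
    have hn : ‖circleMap 0 1 θ‖ = 1 := by simp
    have key := variation_integrand_eq (h := preSchwarzian (f t) (circleMap 0 1 θ))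
      (h' := preSchwarzianDeriv (f t) (circleMap 0 1 θ)) hn (hPG θ)
    have hS : preSchwarzianDeriv (f t) (circleMap 0 1 θ) -
        1 / 2 * preSchwarzian (f t) (circleMap 0 1 θ) ^ 2 =
        schwarzian (f t) (circleMap 0 1 θ) := by
      rw [schwarzian, preSchwarzian, preSchwarzianDeriv]; ring
    have hκ : (1 + circleMap 0 1 θ * preSchwarzian (f t) (circleMap 0 1 θ)).re /
        ‖dζ 1 (f t) (circleMap 0 1 θ)‖ = curvature (f t) (circleMap 0 1 θ) := by
      rw [curvature, preSchwarzian, mul_div_assoc]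
    rw [hS, hκ] at key
    exact key

end Main

end LaplacianGrowth

end

theorem theorem1 (T : ℝ) (Ω : ℝ → Set ℂ) (p : ℝ → ℂ → ℝ) (f : ℝ → ℂ → ℂ)
    (hΩ : LaplacianGrowth.IsStrongSolution T Ω p)
    (hf : LaplacianGrowth.IsParametricFunction T Ω f) :
    ∀ t ∈ Set.Ico 0 T,
      HasDerivWithinAt (fun s => LaplacianGrowth.energy (f s))
        (∫ θ in (0 : ℝ)..2 * Real.pi,
          1 / ‖LaplacianGrowth.dζ 1 (f t) (LaplacianGrowth.circlePt θ)‖ ^ 2)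
        (Set.Ico 0 T) t ∧
      Filter.Tendsto (LaplacianGrowth.regularizedAction (f t)) (nhdsWithin 0 (Set.Ioi 0))
        (nhds (LaplacianGrowth.logAction (f t))) ∧
      HasDerivWithinAt
        (fun s => LaplacianGrowth.logAction (f s) + LaplacianGrowth.energy (f s))
        (2 * (∫ θ in (0 : ℝ)..2 * Real.pi,
            LaplacianGrowth.curvature (f t) (LaplacianGrowth.circlePt θ) ^ 2) +
          ∫ θ in (0 : ℝ)..2 * Real.pi,
            2 / ‖LaplacianGrowth.dζ 1 (f t) (LaplacianGrowth.circlePt θ)‖ ^ 2 *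
              (Complex.exp (2 * θ * Complex.I) *
                LaplacianGrowth.schwarzian (f t) (LaplacianGrowth.circlePt θ)).re)
        (Set.Ico 0 T) t := by
  intro t ht
  obtain ⟨hE, hD⟩ := LaplacianGrowth.hasDerivWithinAt_energy_and_diskIntegral hΩ hf ht
  refine ⟨hE, (LaplacianGrowth.logAction_eq hf ht).1, ?_⟩
  -- The action already contains one energy, so the sum is D + 2E; the two energy derivatives cancel
  -- the subtracted term in `hD`.
  refine (((hD.add hE).add hE).congr (fun s hs => ?_) ?_).congr_deriv (by ring)
  · rw [(LaplacianGrowth.logAction_eq hf hs).2]; rfl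
  · rw [(LaplacianGrowth.logAction_eq hf ht).2]; rfl
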